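/- Let $p$ be a prime number, let $G$ be a finite group and let $H\le G$ be a subgroup whose index $[G:H]$ is prime to $p$. Let $\Bbbk$ be a commutative local ring which is an algebra over $\mathbb Z_{(p)}$ (the localization of $\mathbb Z$ at $(p)$). For every group $K$ among the subgroups of $G$, let $\mathcal C(K)$ denote one of the following categories (the same choice for all $K$): 1. the category $\Bbbk K\text{-}\mathrm{Mod}$ of all left $\Bbbk K$-modules; 2. the (unbounded) derived category $\mathrm D(\Bbbk K)$ of $\Bbbk K\text{-}\mathrm{Mod}$; 3. if $\Bbbk$ is a field, the stable category $\Bbbk K\text{-}\mathrm{Stab}$, i.e. the quotient of $\Bbbk K\text{-}\mathrm{Mod}$ in which two morphisms are identified when their difference factors through a projective module. Notation. For $g,x\in G$ write ${}^g x=gxg^{-1}$, and put $H^g=g^{-1}Hg$, $H[g]=H^g\cap H$ and $H[g_2,g_1]=H^{g_2g_1}\cap H^{g_1}\cap H$. If $K,L\le G$ and ${}^gK\le L$, the $g$-twisted restriction ${}^g\mathrm{Res}^L_K:\mathcal C(L)\to\mathcal C(K)$ is restriction along the homomorphism $K\to L$, $x\mapsto {}^gx$; for $g=1$ it is the usual restriction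 $\mathrm{Res}^L_K$. If $K\le L$ and $l\in L$, then $w\mapsto l\,w$ defines a natural isomorphism $\tau_l:\mathrm{Res}^L_K\to{}^l\mathrm{Res}^L_K$. (In cases 2 and 3 these are induced from $\Bbbk K$-modules, degreewise on complexes in case 2.) Composites of twisted restrictions are identified via ${}^{g_1}\mathrm{Res}\circ{}^{g_2}\mathrm{Res}={}^{g_2g_1}\mathrm{Res}$. (A) Let $V',V''\in\mathcal C(G)$. Then $f_0\mapsto\mathrm{Res}^G_H(f_0)$ is a bijection from the set of morphisms $f_0:V'\to V''$ in $\mathcal C(G)$ onto the set of those morphisms $f:\mathrm{Res}^G_HV'\to\mathrm{Res}^G_HV''$ in $\mathcal C(H)$ such that $${}^g\mathrm{Res}^H_{H[g]}(f)\circ\tau_g=\tau_g\circ\mathrm{Res}^H_{H[g]}(f)\quad\text{in }\mathcal C(H[g])\text{ for all }g\in G.$$ (B) Let $W\in\mathcal C(H)$ and, for every $g\in G$, let $\sigma_g:\mathrm{Res}^H_{H[g]}W\to{}^g\mathrm{Res}^H_{H[g]}W$ be an isomorphism in $\mathcal C(H[g])$. Suppose that (I) $\sigma_h=\tau_h$ in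 $\mathcal C(H)$ for every $h\in H$ (note that $H[h]=H$); (II) for all $g_1,g_2\in G$, $${}^{g_1}\mathrm{Res}^{H[g_2]}_{H[g_2,g_1]}(\sigma_{g_2})\circ\mathrm{Res}^{H[g_1]}_{H[g_2,g_1]}(\sigma_{g_1})=\mathrm{Res}^{H[g_2g_1]}_{H[g_2,g_1]}(\sigma_{g_2g_1})$$ in $\mathcal C(H[g_2,g_1])$, as morphisms $\mathrm{Res}^H_{H[g_2,g_1]}W\to{}^{g_2g_1}\mathrm{Res}^H_{H[g_2,g_1]}W$. Then there are an object $V\in\mathcal C(G)$ and an isomorphism $f:\mathrm{Res}^G_HV\to W$ in $\mathcal C(H)$ such that $${}^g\mathrm{Res}^H_{H[g]}(f)\circ\tau_g=\sigma_g\circ\mathrm{Res}^H_{H[g]}(f)\quad\text{in }\mathcal C(H[g])\text{ for every }g\in G.$$ Moreover the pair $(V,f)$ is unique up to unique isomorphism: if $(V_1,f_1)$ and $(V_2,f_2)$ are two such pairs, there is exactly one isomorphism $e:V_1\to V_2$ in $\mathcal C(G)$ with $f_2\circ\mathrm{Res}^G_H(e)=f_1$. -/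

import Mathlib

open CategoryTheory Limits

universe u a b

noncomputable section

/-! ### Coefficients -/

instance isPrime_span_natCast (p : ℕ) [hp : Fact p.Prime] :
    (Ideal.span {(p : ℤ)}).IsPrime :=
  (Ideal.span_singleton_prime (by exact_mod_cast hp.out.ne_zero)).2
    (Nat.prime_iff_prime_int.1 hp.out)

/-- The ring `ℤ_(p)`, the localization of `ℤ` at the prime ideal `(p)`. -/
abbrev ZLocAt (p : ℕ) [Fact p.Prime] : Type := Localization.AtPrime (Ideal.span {(p : ℤ)})

/-! ### Systems of categories with restriction functors

The three families `C(-)` (plain, derived, stable) come with the same kind of data: a category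
`C(K)` for each group `K`, restriction along injective homomorphisms, the canonical identification
of a composite of restrictions with the restriction along the composite, and the canonical
isomorphisms `τ_l` between restrictions along conjugate homomorphisms. This structure only bundles
these data, so that the statement can be written once; it is used only for the three concrete
systems `plainSystem`, `derivedSystem` and `stableSystem` built below. -/
structure ResSystem where
  /-- the category `C(K)` -/
  Cat (K : Type u) [Group K] : Type a
  [cat (K : Type u) [Group K] : Category.{b} (Cat K)]
  /-- restriction along an injective homomorphism -/
  res {K L : Type u} [Group K] [Group L] (φ : K →* L) (hφ : Function.Injective φ) : Cat L ⥤ Cat K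
  /-- the identification of `Res_ψ ∘ Res_φ` with `Res_χ`, where `χ = φ ∘ ψ` -/
  resComp {J K L : Type u} [Group J] [Group K] [Group L]
    (ψ : J →* K) (hψ : Function.Injective ψ) (φ : K →* L) (hφ : Function.Injective φ)
    (χ : J →* L) (hχ : Function.Injective χ) (h : ∀ x, χ x = φ (ψ x)) :
    res φ hφ ⋙ res ψ hψ ≅ res χ hχ
  /-- the isomorphism `τ_l : Res_φ ≅ Res_ψ` given by the action of `l`, where `ψ = l φ l⁻¹` -/
  twist {K L : Type u} [Group K] [Group L] (φ : K →* L) (hφ : Function.Injective φ)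
    (ψ : K →* L) (hψ : Function.Injective ψ) (l : L) (h : ∀ x, ψ x = l * φ x * l⁻¹) :
    res φ hφ ≅ res ψ hψ

attribute [instance] ResSystem.cat

/-! ### Plain representations -/

namespace PlainRep

variable {k : Type u} [CommRing k] {J K L : Type u} [Group J] [Group K] [Group L]

/-- `Res_ψ ∘ Res_φ = Res_χ` when `χ = φ ∘ ψ`: the identity map of the underlying modules. -/
def resCompIso (ψ : J →* K) (φ : K →* L) (χ : J →* L) (h : ∀ x, χ x = φ (ψ x)) :
    Rep.resFunctor.{u} (k := k) φ ⋙ Rep.resFunctor.{u} (k := k) ψ ≅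
      Rep.resFunctor.{u} (k := k) χ :=
  NatIso.ofComponents
    (fun W ↦
      { hom := Rep.ofHom ⟨LinearMap.id, fun x ↦ by ext; simp [h]⟩
        inv := Rep.ofHom ⟨LinearMap.id, fun x ↦ by ext; simp [h]⟩
        hom_inv_id := by ext x; rfl
        inv_hom_id := by ext x; rfl })
    (fun {V W} f ↦ by ext x; rfl)

/-- If `ψ x = l (φ x) l⁻¹` for all `x`, then the action of `l` is a natural isomorphism
`τ_l : Res_φ W ≅ Res_ψ W`, `w ↦ l w`. -/
def twistIso (φ ψ : K →* L) (l : L) (h : ∀ x, ψ x = l * φ x * l⁻¹) :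
    Rep.resFunctor.{u} (k := k) φ ≅ Rep.resFunctor.{u} (k := k) ψ :=
  NatIso.ofComponents
    (fun W ↦
      { hom := Rep.ofHom ⟨W.ρ l, fun x ↦ by
          simp only [MonoidHom.comp_apply, h, ← Module.End.mul_eq_comp, ← map_mul]; simp⟩
        inv := Rep.ofHom ⟨W.ρ l⁻¹, fun x ↦ by
          simp only [MonoidHom.comp_apply, h, ← Module.End.mul_eq_comp, ← map_mul]
          simp [mul_assoc]⟩
        hom_inv_id := by ext x; simp
        inv_hom_id := by ext x; simp })
    (fun {V W} f ↦ by ext x; simp [Rep.hom_comm_apply])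

/-- Restriction along an injective homomorphism preserves projective representations. -/
theorem res_projective (φ : K →* L) (hφ : Function.Injective φ) (P : Rep.{u} k L)
    [Projective P] : Projective ((Rep.resFunctor.{u} (k := k) φ).obj P) := by
  let e : K ≃* φ.range := MonoidHom.ofInjective hφ
  let F := Rep.resFunctor.{u} (k := k) e.toMonoidHom
  have : F.Full := Rep.full_res _ e.surjective
  have : F.EssSurj := ⟨fun M ↦ ⟨(Rep.resFunctor.{u} (k := k) e.symm.toMonoidHom).obj M,
    ⟨(resCompIso e.toMonoidHom e.symm.toMonoidHom (MonoidHom.id K)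
      (fun x ↦ by simp)).app M⟩⟩⟩
  have : F.IsEquivalence := {}
  have h1 : Projective ((Rep.resFunctor.{u} (k := k) φ.range.subtype).obj P) :=
    Functor.projective_obj_of_projective _ ‹_›
  have h2 : Projective (F.obj ((Rep.resFunctor.{u} (k := k) φ.range.subtype).obj P)) :=
    (F.asEquivalence.map_projective_iff _).2 h1
  exact Projective.of_iso
    ((resCompIso e.toMonoidHom φ.range.subtype φ (fun x ↦ rfl)).app P) h2

end PlainRep

/-- Plain representations: `C(K)` is the category of `kK`-modules. -/
def plainSystem (k : Type u) [CommRing k] : ResSystem.{u, u + 1, u} where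
  Cat K _ := Rep.{u} k K
  res φ _ := Rep.resFunctor φ
  resComp ψ _ φ _ χ _ h := PlainRep.resCompIso ψ φ χ h
  twist φ _ ψ _ l h := PlainRep.twistIso φ ψ l h

/-! ### Derived categories -/

section Derived

attribute [local instance] HasDerivedCategory.standard

variable {A B C : Type (u + 1)} [Category.{u} A] [Category.{u} B] [Category.{u} C]
  [Abelian A] [Abelian B] [Abelian C]

/-- An isomorphism of exact functors induces, degreewise on complexes, an isomorphism of the
functors induced on derived categories. -/
def derivedMapIso {F F' : A ⥤ B}
    [F.Additive] [PreservesFiniteLimits F] [PreservesFiniteColimits F]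
    [F'.Additive] [PreservesFiniteLimits F'] [PreservesFiniteColimits F'] (e : F ≅ F') :
    F.mapDerivedCategory ≅ F'.mapDerivedCategory :=
  Localization.liftNatIso DerivedCategory.Q
    (HomologicalComplex.quasiIso A (ComplexShape.up ℤ))
    (F.mapHomologicalComplex (ComplexShape.up ℤ) ⋙ DerivedCategory.Q)
    (F'.mapHomologicalComplex (ComplexShape.up ℤ) ⋙ DerivedCategory.Q)
    F.mapDerivedCategory F'.mapDerivedCategory
    (Functor.isoWhiskerRight (NatIso.mapHomologicalComplex e _) DerivedCategory.Q)

/-- The functors induced on derived categories by two exact functors `F` and `F'` compose to the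
functor induced by their composite. -/
def derivedCompIso (F : A ⥤ B) (F' : B ⥤ C)
    [F.Additive] [PreservesFiniteLimits F] [PreservesFiniteColimits F]
    [F'.Additive] [PreservesFiniteLimits F'] [PreservesFiniteColimits F'] :
    F.mapDerivedCategory ⋙ F'.mapDerivedCategory ≅ (F ⋙ F').mapDerivedCategory :=
  letI : Localization.Lifting DerivedCategory.Q
      (HomologicalComplex.quasiIso A (ComplexShape.up ℤ))
      ((F ⋙ F').mapHomologicalComplex (ComplexShape.up ℤ) ⋙ DerivedCategory.Q)
      (F.mapDerivedCategory ⋙ F'.mapDerivedCategory) :=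
    ⟨(Functor.associator _ _ _).symm ≪≫
      Functor.isoWhiskerRight F.mapDerivedCategoryFactors F'.mapDerivedCategory ≪≫
      Functor.associator _ _ _ ≪≫
      Functor.isoWhiskerLeft _ F'.mapDerivedCategoryFactors ≪≫
      (Functor.associator _ _ _).symm ≪≫
      Functor.isoWhiskerRight
        (Functor.mapHomologicalComplexCompIso (Iso.refl (F ⋙ F')) _) DerivedCategory.Q⟩
  Localization.liftNatIso DerivedCategory.Q
    (HomologicalComplex.quasiIso A (ComplexShape.up ℤ))
    ((F ⋙ F').mapHomologicalComplex (ComplexShape.up ℤ) ⋙ DerivedCategory.Q)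
    ((F ⋙ F').mapHomologicalComplex (ComplexShape.up ℤ) ⋙ DerivedCategory.Q)
    (F.mapDerivedCategory ⋙ F'.mapDerivedCategory) (F ⋙ F').mapDerivedCategory (Iso.refl _)

/-- Derived categories: `C(K) = D(kK)` is the (unbounded) derived category of the category of
`kK`-modules, and restriction is induced by the (exact) plain restriction functor. -/
def derivedSystem (k : Type u) [CommRing k] : ResSystem.{u, u + 1, u + 1} where
  Cat K _ := DerivedCategory (Rep.{u} k K)
  res φ _ := (Rep.resFunctor.{u} (k := k) φ).mapDerivedCategory
  resComp ψ _ φ _ χ _ h :=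
    derivedCompIso (Rep.resFunctor.{u} (k := k) φ) (Rep.resFunctor.{u} (k := k) ψ) ≪≫
      derivedMapIso (PlainRep.resCompIso ψ φ χ h)
  twist φ _ ψ _ l h := derivedMapIso (PlainRep.twistIso φ ψ l h)

end Derived

/-! ### Stable categories -/

/-- Two morphisms of representations are stably equal if their difference factors through a
projective representation. -/
def stableRel (k : Type u) [CommRing k] (K : Type u) [Group K] : HomRel (Rep.{u} k K) :=
  fun X Y f g ↦ ∃ (P : Rep.{u} k K) (i : X ⟶ P) (q : P ⟶ Y), Projective P ∧ f - g = i ≫ q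

open scoped ZeroObject in
instance stableRel_congruence (k : Type u) [CommRing k] (K : Type u) [Group K] :
    Congruence (stableRel k K) where
  equivalence :=
    { refl := fun f ↦ ⟨0, 0, 0, inferInstance, by simp⟩
      symm := by
        rintro f g ⟨P, i, q, hP, h⟩
        exact ⟨P, -i, q, hP, by rw [Preadditive.neg_comp, ← h, neg_sub]⟩
      trans := by
        rintro f g l ⟨P, i, q, hP, h⟩ ⟨P', i', q', hP', h'⟩
        refine ⟨P ⊞ P', biprod.lift i i', biprod.desc q q', inferInstance, ?_⟩
        rw [biprod.lift_desc, ← h, ← h', sub_add_sub_cancel] }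
  comp_left := by
    rintro X Y Z f g g' ⟨P, i, q, hP, h⟩
    exact ⟨P, f ≫ i, q, hP, by rw [← Preadditive.comp_sub, h, Category.assoc]⟩
  comp_right := by
    rintro X Y Z f f' g ⟨P, i, q, hP, h⟩
    exact ⟨P, i, q ≫ g, hP, by rw [← Preadditive.sub_comp, h, Category.assoc]⟩

/-- The stable category of `kK`-modules: the additive quotient of the category of `kK`-modules
by the projective modules. -/
abbrev StableRep (k : Type u) [CommRing k] (K : Type u) [Group K] : Type (u + 1) :=
  CategoryTheory.Quotient (stableRel k K)

namespace StableRep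

variable {k : Type u} [CommRing k] {K L : Type u} [Group K] [Group L]

/-- Restriction on stable categories. -/
def res (φ : K →* L) (hφ : Function.Injective φ) : StableRep k L ⥤ StableRep k K :=
  CategoryTheory.Quotient.lift _
    (Rep.resFunctor.{u} (k := k) φ ⋙ CategoryTheory.Quotient.functor (stableRel k K)) (by
    rintro X Y f g ⟨P, i, q, hP, h⟩
    refine CategoryTheory.Quotient.sound _ ⟨(Rep.resFunctor φ).obj P, (Rep.resFunctor φ).map i,
      (Rep.resFunctor φ).map q, PlainRep.res_projective φ hφ P, ?_⟩
    rw [← Functor.map_sub, h, Functor.map_comp])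

end StableRep

/-- Stable categories: `C(K)` is the stable category of `kK`-modules. All the structure is
induced by the plain one. -/
def stableSystem (k : Type u) [Field k] : ResSystem.{u, u + 1, u} where
  Cat K _ := StableRep k K
  res φ hφ := StableRep.res φ hφ
  resComp ψ hψ φ hφ χ hχ h := CategoryTheory.Quotient.natIsoLift _
    (Functor.isoWhiskerRight (PlainRep.resCompIso ψ φ χ h)
        (CategoryTheory.Quotient.functor (stableRel k _)) :
      CategoryTheory.Quotient.functor (stableRel k _) ⋙ StableRep.res φ hφ ⋙ StableRep.res ψ hψ ≅
        CategoryTheory.Quotient.functor (stableRel k _) ⋙ StableRep.res χ hχ)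
  twist φ hφ ψ hψ l h := CategoryTheory.Quotient.natIsoLift _
    (Functor.isoWhiskerRight (PlainRep.twistIso φ ψ l h)
        (CategoryTheory.Quotient.functor (stableRel k _)) :
      CategoryTheory.Quotient.functor (stableRel k _) ⋙ StableRep.res φ hφ ≅
        CategoryTheory.Quotient.functor (stableRel k _) ⋙ StableRep.res ψ hψ)

/-! ### Subgroups, conjugation and twisted restriction -/

section Subgroups

variable {G : Type u} [Group G]

/-- `H^g = g⁻¹ H g`. -/
def conjBy (H : Subgroup G) (g : G) : Subgroup G := H.map (MulAut.conj g⁻¹).toMonoidHom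

theorem mem_conjBy {H : Subgroup G} {g x : G} : x ∈ conjBy H g ↔ g * x * g⁻¹ ∈ H := by
  constructor
  · rintro ⟨y, hy, rfl⟩
    simpa [mul_assoc] using hy
  · intro h
    exact ⟨_, h, by simp [mul_assoc]⟩

/-- `H[g] = H^g ∩ H`. -/
def inter1 (H : Subgroup G) (g : G) : Subgroup G := conjBy H g ⊓ H

/-- `H[g₂, g₁] = H^{g₂ g₁} ∩ H^{g₁} ∩ H`. -/
def inter2 (H : Subgroup G) (g₂ g₁ : G) : Subgroup G := conjBy H (g₂ * g₁) ⊓ conjBy H g₁ ⊓ H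

/-- For `K, L ≤ G` with `g K g⁻¹ ≤ L`, the homomorphism `K → L`, `x ↦ g x g⁻¹`. -/
def conjHom (g : G) (K L : Subgroup G) (h : ∀ x ∈ K, g * x * g⁻¹ ∈ L) : K →* L :=
  ((MulAut.conj g).toMonoidHom.comp K.subtype).codRestrict L fun x ↦ h x x.2

theorem conjHom_injective (g : G) (K L : Subgroup G) (h : ∀ x ∈ K, g * x * g⁻¹ ∈ L) :
    Function.Injective (conjHom g K L h) := fun _ _ hxy ↦
  Subtype.ext ((MulAut.conj g).injective (congrArg Subtype.val hxy))

/-- The homomorphism `K → G`, `x ↦ g x g⁻¹`. -/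
def conjHomTop (g : G) (K : Subgroup G) : K →* G := (MulAut.conj g).toMonoidHom.comp K.subtype

theorem conjHomTop_injective (g : G) (K : Subgroup G) : Function.Injective (conjHomTop g K) :=
  (MulAut.conj g).injective.comp K.subtype_injective

theorem inter1_conj (H : Subgroup G) (g : G) : ∀ x ∈ inter1 H g, g * x * g⁻¹ ∈ H :=
  fun _ hx ↦ mem_conjBy.1 hx.1

theorem inter2_conj (H : Subgroup G) (g₂ g₁ : G) : ∀ x ∈ inter2 H g₂ g₁, g₁ * x * g₁⁻¹ ∈ H :=
  fun _ hx ↦ mem_conjBy.1 hx.1.2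

theorem inter2_conj_mul (H : Subgroup G) (g₂ g₁ : G) :
    ∀ x ∈ inter2 H g₂ g₁, (g₂ * g₁) * x * (g₂ * g₁)⁻¹ ∈ H :=
  fun _ hx ↦ mem_conjBy.1 hx.1.1

theorem inter2_le (H : Subgroup G) (g₂ g₁ : G) : inter2 H g₂ g₁ ≤ inter1 H g₁ :=
  fun _ hx ↦ ⟨hx.1.2, hx.2⟩

theorem inter2_le_mul (H : Subgroup G) (g₂ g₁ : G) : inter2 H g₂ g₁ ≤ inter1 H (g₂ * g₁) :=
  fun _ hx ↦ ⟨hx.1.1, hx.2⟩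

theorem inter2_conj_mem (H : Subgroup G) (g₂ g₁ : G) :
    ∀ x ∈ inter2 H g₂ g₁, g₁ * x * g₁⁻¹ ∈ inter1 H g₂ :=
  fun _ hx ↦ ⟨mem_conjBy.2 (by simpa [mul_assoc] using mem_conjBy.1 hx.1.1),
    mem_conjBy.1 hx.1.2⟩

end Subgroups

namespace ResSystem

variable (S : ResSystem.{u, a, b}) {G : Type u} [Group G]

/-- `Res^G_K` for `K ≤ G`. -/
def resTop (K : Subgroup G) : S.Cat G ⥤ S.Cat K := S.res K.subtype K.subtype_injective

/-- The `g`-twisted restriction `ᵍRes^G_K` for `K ≤ G`. -/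
def gResTop (g : G) (K : Subgroup G) : S.Cat G ⥤ S.Cat K :=
  S.res (conjHomTop g K) (conjHomTop_injective g K)

/-- `Res^L_K` for `K ≤ L ≤ G`. -/
def resSub {K L : Subgroup G} (h : K ≤ L) : S.Cat L ⥤ S.Cat K :=
  S.res (Subgroup.inclusion h) (Subgroup.inclusion_injective h)

/-- The `g`-twisted restriction `ᵍRes^L_K` for `K, L ≤ G` with `g K g⁻¹ ≤ L`. -/
def gRes (g : G) {K L : Subgroup G} (h : ∀ x ∈ K, g * x * g⁻¹ ∈ L) : S.Cat L ⥤ S.Cat K :=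
  S.res (conjHom g K L h) (conjHom_injective g K L h)

/-- `τ_g : Res^G_K ≅ ᵍRes^G_K`, the action of `g ∈ G`. -/
def tauTop (g : G) (K : Subgroup G) : S.resTop K ≅ S.gResTop g K :=
  S.twist _ _ _ _ g fun _ ↦ rfl

/-- `τ_h : Res^L_K ≅ ʰRes^L_K`, the action of `h ∈ L`, for `K ≤ L ≤ G`. -/
def tauSub {K L : Subgroup G} (hKL : K ≤ L) (h : L)
    (hc : ∀ x ∈ K, (h : G) * x * (h : G)⁻¹ ∈ L) : S.resSub hKL ≅ S.gRes (h : G) hc :=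
  S.twist _ _ _ _ h fun _ ↦ rfl

/-- `Res^L_K Res^G_L = Res^G_K`. -/
def resTopComp {K L : Subgroup G} (h : K ≤ L) : S.resTop L ⋙ S.resSub h ≅ S.resTop K :=
  S.resComp _ _ _ _ _ _ fun _ ↦ rfl

/-- `ᵍRes^L_K Res^G_L = ᵍRes^G_K`. -/
def gResTopComp (g : G) {K L : Subgroup G} (h : ∀ x ∈ K, g * x * g⁻¹ ∈ L) :
    S.resTop L ⋙ S.gRes g h ≅ S.gResTop g K :=
  S.resComp _ _ _ _ _ _ fun _ ↦ rfl

/-- `Res^L_K Res^M_L = Res^M_K`. -/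
def resSubComp {K L M : Subgroup G} (h : K ≤ L) (h' : L ≤ M) :
    S.resSub h' ⋙ S.resSub h ≅ S.resSub (h.trans h') :=
  S.resComp _ _ _ _ _ _ fun _ ↦ rfl

/-- `Res^L_K ᵍRes^M_L = ᵍRes^M_K`. -/
def gResCompRes (g : G) {K L M : Subgroup G} (h : K ≤ L) (h' : ∀ x ∈ L, g * x * g⁻¹ ∈ M)
    (h'' : ∀ x ∈ K, g * x * g⁻¹ ∈ M) : S.gRes g h' ⋙ S.resSub h ≅ S.gRes g h'' :=
  S.resComp _ _ _ _ _ _ fun _ ↦ rfl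

/-- `ᵍRes^L_K Res^M_L = ᵍRes^M_K`. -/
def resCompGRes (g : G) {K L M : Subgroup G} (h : ∀ x ∈ K, g * x * g⁻¹ ∈ L) (h' : L ≤ M)
    (h'' : ∀ x ∈ K, g * x * g⁻¹ ∈ M) : S.resSub h' ⋙ S.gRes g h ≅ S.gRes g h'' :=
  S.resComp _ _ _ _ _ _ fun _ ↦ rfl

/-- `^{g₁}Res^L_K ^{g₂}Res^M_L = ^{g₂g₁}Res^M_K`. -/
def gResComp (g₂ g₁ : G) {K L M : Subgroup G} (h : ∀ x ∈ K, g₁ * x * g₁⁻¹ ∈ L)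
    (h' : ∀ x ∈ L, g₂ * x * g₂⁻¹ ∈ M)
    (h'' : ∀ x ∈ K, (g₂ * g₁) * x * (g₂ * g₁)⁻¹ ∈ M) :
    S.gRes g₂ h' ⋙ S.gRes g₁ h ≅ S.gRes (g₂ * g₁) h'' :=
  S.resComp _ _ _ _ _ _ fun x ↦ Subtype.ext (by simp [conjHom, mul_assoc])

/-- A morphism `f : Res^G_H V' ⟶ Res^G_H V''` is `G`-invariant if
`ᵍRes^H_{H[g]}(f) ∘ τ_g = τ_g ∘ Res^H_{H[g]}(f)` in `C(H[g])` for all `g ∈ G`. -/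
def IsInvariant (H : Subgroup G) {V' V'' : S.Cat G}
    (f : (S.resTop H).obj V' ⟶ (S.resTop H).obj V'') : Prop :=
  ∀ g : G,
    (S.tauTop g (inter1 H g)).hom.app V' ≫
      ((S.gResTopComp g (inter1_conj H g)).inv.app V' ≫
        (S.gRes g (inter1_conj H g)).map f ≫
          (S.gResTopComp g (inter1_conj H g)).hom.app V'') =
    ((S.resTopComp (inf_le_right : inter1 H g ≤ H)).inv.app V' ≫
        (S.resSub (inf_le_right : inter1 H g ≤ H)).map f ≫
          (S.resTopComp (inf_le_right : inter1 H g ≤ H)).hom.app V'') ≫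
      (S.tauTop g (inter1 H g)).hom.app V''

/-- A family of isomorphisms `σ_g : Res^H_{H[g]} W ≅ ᵍRes^H_{H[g]} W` in `C(H[g])`, `g ∈ G`. -/
abbrev GluingFamily (H : Subgroup G) (W : S.Cat H) :=
  ∀ g : G, (S.resSub (inf_le_right : inter1 H g ≤ H)).obj W ≅
    (S.gRes g (inter1_conj H g)).obj W

/-- Condition (I): `σ_h = τ_h` for all `h ∈ H` (where `H[h] = H`). -/
def ExtendsTau {H : Subgroup G} {W : S.Cat H} (σ : S.GluingFamily H W) : Prop :=
  ∀ h : H, (σ h).hom =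
    (S.tauSub (inf_le_right : inter1 H (h : G) ≤ H) h (inter1_conj H h)).hom.app W

/-- Condition (II), the cocycle condition: in `C(H[g₂, g₁])`,
`^{g₁}Res(σ_{g₂}) ∘ Res(σ_{g₁}) = Res(σ_{g₂g₁})` as morphisms
`Res^H_{H[g₂,g₁]} W ⟶ ^{g₂g₁}Res^H_{H[g₂,g₁]} W`. -/
def IsCocycle {H : Subgroup G} {W : S.Cat H} (σ : S.GluingFamily H W) : Prop :=
  ∀ g₁ g₂ : G,
    ((S.resSubComp (inter2_le H g₂ g₁) inf_le_right).inv.app W ≫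
        (S.resSub (inter2_le H g₂ g₁)).map (σ g₁).hom ≫
          (S.gResCompRes g₁ (inter2_le H g₂ g₁) (inter1_conj H g₁)
            (inter2_conj H g₂ g₁)).hom.app W) ≫
      ((S.resCompGRes g₁ (inter2_conj_mem H g₂ g₁) inf_le_right
            (inter2_conj H g₂ g₁)).inv.app W ≫
        (S.gRes g₁ (inter2_conj_mem H g₂ g₁)).map (σ g₂).hom ≫
          (S.gResComp g₂ g₁ (inter2_conj_mem H g₂ g₁) (inter1_conj H g₂)
            (inter2_conj_mul H g₂ g₁)).hom.app W) =
    (S.resSubComp (inter2_le_mul H g₂ g₁) inf_le_right).inv.app W ≫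
      (S.resSub (inter2_le_mul H g₂ g₁)).map (σ (g₂ * g₁)).hom ≫
        (S.gResCompRes (g₂ * g₁) (inter2_le_mul H g₂ g₁) (inter1_conj H (g₂ * g₁))
          (inter2_conj_mul H g₂ g₁)).hom.app W

/-- The isomorphism `f : Res^G_H V ≅ W` is compatible with the family `σ`: for every `g ∈ G`,
`ᵍRes^H_{H[g]}(f) ∘ τ_g = σ_g ∘ Res^H_{H[g]}(f)` as morphisms
`Res^G_{H[g]} V ⟶ ᵍRes^H_{H[g]} W` in `C(H[g])`. -/
def IsExtension {H : Subgroup G} {W : S.Cat H} (σ : S.GluingFamily H W) (V : S.Cat G)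
    (f : (S.resTop H).obj V ≅ W) : Prop :=
  ∀ g : G,
    (S.tauTop g (inter1 H g)).hom.app V ≫
      ((S.gResTopComp g (inter1_conj H g)).inv.app V ≫
        (S.gRes g (inter1_conj H g)).map f.hom) =
    ((S.resTopComp (inf_le_right : inter1 H g ≤ H)).inv.app V ≫
        (S.resSub (inf_le_right : inter1 H g ≤ H)).map f.hom) ≫
      (σ g).hom

/-- Part (A): restriction `f₀ ↦ Res^G_H(f₀)` is a bijection from the morphisms `V' ⟶ V''` in
`C(G)` onto the `G`-invariant morphisms `Res^G_H V' ⟶ Res^G_H V''` in `C(H)`. -/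
def MorphismsDescend (H : Subgroup G) : Prop :=
  ∀ V' V'' : S.Cat G,
    Set.BijOn (fun f₀ : V' ⟶ V'' ↦ (S.resTop H).map f₀) Set.univ {f | S.IsInvariant H f}

/-- Part (B): every object `W` of `C(H)` with a family `σ` that satisfies (I) and (II) extends to
an object of `C(G)` compatibly with `σ`, and the extension `(V, f)` is unique up to unique
isomorphism of such pairs. -/
def ObjectsDescend (H : Subgroup G) : Prop :=
  ∀ (W : S.Cat H) (σ : S.GluingFamily H W), S.ExtendsTau σ → S.IsCocycle σ →
    (∃ (V : S.Cat G) (f : (S.resTop H).obj V ≅ W), S.IsExtension σ V f) ∧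
    ∀ (V₁ V₂ : S.Cat G) (f₁ : (S.resTop H).obj V₁ ≅ W) (f₂ : (S.resTop H).obj V₂ ≅ W),
      S.IsExtension σ V₁ f₁ → S.IsExtension σ V₂ f₂ →
        ∃! e : V₁ ≅ V₂, (S.resTop H).map e.hom ≫ f₂.hom = f₁.hom

end ResSystem

end

/-!
Since the index of `H` is invertible in `k`, averaging over cosets splits the unit of the adjunction
`Res ⊣ Coind` between `C(G)` and `C(H)`. For an adjunction with split unit into a weakly idempotent
complete category, morphisms and objects descend along coactions `W ⟶ Res (Coind W)` of the induced
comonad, as soon as idempotents split in `C(G)`. By the Mackey formula such a coaction has one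
component `Res W ⟶ ᵍRes W` over `H[g]` for every `g`, and its counit and coassociativity conditions
are (I) and (II).

The three families of categories are treated at once: functors and natural transformations between
categories of representations induce functors and natural transformations on each of them, so every
coherence needed is one about natural transformations in `Rep`. Idempotents split in `C(G)` by an
Eilenberg swindle, since a split monomorphism has a complement and countable copowers exist.
-/

noncomputable section

/-! ### Weakly idempotent complete categories -/

/-- A preadditive category is weakly idempotent complete if every split monomorphism has a
complement. -/
def IsWeaklyIdempotentComplete (C : Type*) [Category C] [Preadditive C] : Prop :=
  ∀ ⦃X Y : C⦄ (f : X ⟶ Y) (r : Y ⟶ X), f ≫ r = 𝟙 X →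
    ∃ (Z : C) (i : Z ⟶ Y) (q : Y ⟶ Z), i ≫ q = 𝟙 Z ∧ q ≫ i = 𝟙 Y - r ≫ f

theorem isWeaklyIdempotentComplete_of_isIdempotentComplete (C : Type*) [Category C]
    [Preadditive C] [IsIdempotentComplete C] : IsWeaklyIdempotentComplete C := fun _ Y f r h ↦
  IsIdempotentComplete.idempotents_split Y (𝟙 Y - r ≫ f) (by simp [reassoc_of% h])

theorem isWeaklyIdempotentComplete_of_pretriangulated (C : Type*) [Category C] [HasZeroObject C]
    [HasShift C ℤ] [Preadditive C] [∀ n : ℤ, (shiftFunctor C n).Additive] [Pretriangulated C] :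
    IsWeaklyIdempotentComplete C := by
  intro X Y f r h
  obtain ⟨Z, q, d, hT⟩ := Pretriangulated.distinguished_cocone_triangle f
  have hfq : f ≫ q = 0 := Pretriangulated.comp_distTriang_mor_zero₁₂ _ hT
  obtain ⟨i, hi⟩ : ∃ i : Z ⟶ Y, 𝟙 Y - r ≫ f = q ≫ i :=
    Pretriangulated.Triangle.yoneda_exact₂ _ hT (𝟙 Y - r ≫ f)
      (show f ≫ (𝟙 Y - r ≫ f) = 0 by simp [reassoc_of% h])
  have : IsSplitMono f := ⟨⟨⟨r, h⟩⟩⟩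
  have hd : d = 0 := (Pretriangulated.Triangle.mor₃_eq_zero_iff_mono₁ _ hT).2
    (inferInstanceAs (Mono f))
  have : Epi q := (Pretriangulated.Triangle.mor₃_eq_zero_iff_epi₂ _ hT).1 hd
  refine ⟨Z, i, q, ?_, hi.symm⟩
  rw [← cancel_epi q, ← Category.assoc, ← hi]
  simp [hfq]

/- Eilenberg swindle: the hypotheses say `N ≅ 𝟭 ⊕ N`. For an idempotent `e` of `X`, the
endomorphism `1 - N e + N e ∘ σ` of `N X` has a left inverse, and the complement of its image is
cut out by the idempotent `p ≫ e ≫ z`. -/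
theorem IsWeaklyIdempotentComplete.isIdempotentComplete {C : Type*} [Category C] [Preadditive C]
    (hC : IsWeaklyIdempotentComplete C) {N : C ⥤ C} {σ δ : N ⟶ N} {z : 𝟭 C ⟶ N} {p : N ⟶ 𝟭 C}
    (hσδ : σ ≫ δ = 𝟙 N) (hδσ : δ ≫ σ = 𝟙 N - p ≫ z) (hzp : z ≫ p = 𝟙 (𝟭 C)) :
    IsIdempotentComplete C where
  idempotents_split X e he := by
    let E (α : N ⟶ N) : N.obj X ⟶ N.obj X := 𝟙 _ - N.map e + N.map e ≫ α.app X
    have E_comp (α β : N ⟶ N) : E α ≫ E β = E (α ≫ β) := by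
      have hee : N.map e ≫ N.map e = N.map e := by rw [← N.map_comp, he]
      simp only [E, NatTrans.comp_app, Preadditive.comp_add, Preadditive.add_comp,
        Preadditive.comp_sub, Preadditive.sub_comp, Category.comp_id, Category.id_comp,
        Category.assoc, reassoc_of% hee, hee, ← α.naturality, ← α.naturality_assoc]
      abel
    have E_id : E (𝟙 N) = 𝟙 _ := by simp [E]
    obtain ⟨Z, i, q, hiq, hqi⟩ := hC (E σ) (E δ) (by rw [E_comp, hσδ, E_id])
    have hz : z.app X ≫ N.map e = e ≫ z.app X := (z.naturality e).symm
    replace hqi : q ≫ i = p.app X ≫ e ≫ z.app X := by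
      rw [hqi, E_comp, hδσ]
      simp [E, hz]
    have hzpX : z.app X ≫ p.app X = 𝟙 X := congr_app hzp X
    refine ⟨Z, i ≫ p.app X ≫ e, e ≫ z.app X ≫ q, ?_, ?_⟩
    · simp only [Category.assoc, reassoc_of% he]
      rw [← reassoc_of% hqi, reassoc_of% hiq, hiq]
    · simp only [Category.assoc, reassoc_of% hqi, reassoc_of% hzpX, he]

/-! ### Systems of categories functorial in exact functors -/

/-- An additive exact functor between categories of representations that preserves projective
objects: this is what it takes to induce a functor on plain representations, on derived categories
and on stable categories. -/
structure RepFunctor (k : Type u) [CommRing k] (K L : Type u) [Group K] [Group L] where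
  /-- the underlying functor -/
  functor : Rep.{u} k K ⥤ Rep.{u} k L
  [additive : functor.Additive]
  [preservesFiniteLimits : PreservesFiniteLimits functor]
  [preservesFiniteColimits : PreservesFiniteColimits functor]
  [preservesProjectiveObjects : functor.PreservesProjectiveObjects]

namespace RepFunctor

attribute [instance] additive preservesFiniteLimits preservesFiniteColimits
  preservesProjectiveObjects

variable {k : Type u} [CommRing k] {J K L : Type u} [Group J] [Group K] [Group L]

variable (k K) in
/-- The identity functor. -/
abbrev id : RepFunctor k K K :=
  { functor := 𝟭 _
    preservesProjectiveObjects := ⟨fun h ↦ h⟩ }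

/-- The composite of two functors, in diagrammatic order. -/
abbrev comp (A : RepFunctor k J K) (B : RepFunctor k K L) : RepFunctor k J L where
  functor := A.functor ⋙ B.functor

variable (k) in
/-- Restriction along an injective homomorphism. -/
abbrev res (φ : K →* L) (hφ : Function.Injective φ) : RepFunctor k L K :=
  { functor := Rep.resFunctor.{u} (k := k) φ
    preservesProjectiveObjects := ⟨fun {P} (_ : Projective P) ↦ PlainRep.res_projective φ hφ P⟩ }

variable (k) in
/-- Coinduction from a subgroup of finite index. Being also left adjoint to restriction, it is
exact and preserves projective objects. -/
abbrev coind (H : Subgroup L) [H.FiniteIndex] : RepFunctor k H L :=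
  { functor := Rep.coindFunctor.{u} k H.subtype
    additive := ⟨rfl⟩
    preservesFiniteLimits :=
      have : PreservesLimitsOfSize.{0, 0} (Rep.coindFunctor.{u} k H.subtype) :=
        (Rep.resCoindAdjunction.{u} k H.subtype).rightAdjoint_preservesLimits
      PreservesLimitsOfSize.preservesFiniteLimits _
    preservesFiniteColimits := by
      classical
      have : PreservesColimitsOfSize.{0, 0} (Rep.coindFunctor.{u} k H.subtype) :=
        (Rep.coindResAdjunction.{u} k H).leftAdjoint_preservesColimits
      exact PreservesColimitsOfSize.preservesFiniteColimits _
    preservesProjectiveObjects := by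
      classical
      exact Functor.preservesProjectiveObjects_of_adjunction_of_preservesEpimorphisms
        (Rep.coindResAdjunction.{u} k H) }

end RepFunctor

/-- A system of preadditive categories `C(K)` in which every additive exact functor that preserves
projective objects, and every natural transformation between such functors, induces a functor
resp. a natural transformation: an additive pseudofunctor on the 2-category of the categories
`Rep k K`. The coherence axioms are stated componentwise. -/
structure RepSystem (k : Type u) [CommRing k] where
  /-- the category `C(K)` -/
  Cat (K : Type u) [Group K] : Type a
  [cat (K : Type u) [Group K] : Category.{b} (Cat K)]
  [preadditive (K : Type u) [Group K] : Preadditive (Cat K)]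
  /-- the functor induced by an exact functor -/
  map {K L : Type u} [Group K] [Group L] (A : RepFunctor k K L) : Cat K ⥤ Cat L
  [map_additive {K L : Type u} [Group K] [Group L] (A : RepFunctor k K L) : (map A).Additive]
  /-- the natural transformation induced by a natural transformation -/
  map₂ {K L : Type u} [Group K] [Group L] {A B : RepFunctor k K L} (γ : A.functor ⟶ B.functor) :
    map A ⟶ map B
  /-- compatibility with composition -/
  mapComp {J K L : Type u} [Group J] [Group K] [Group L] (A : RepFunctor k J K)
    (B : RepFunctor k K L) : map A ⋙ map B ≅ map (A.comp B)
  /-- compatibility with identities -/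
  mapId (K : Type u) [Group K] : 𝟭 (Cat K) ≅ map (RepFunctor.id k K)
  map₂_id {K L : Type u} [Group K] [Group L] (A : RepFunctor k K L) :
    map₂ (𝟙 A.functor) = 𝟙 (map A)
  map₂_comp {K L : Type u} [Group K] [Group L] {A B C : RepFunctor k K L}
    (γ : A.functor ⟶ B.functor) (δ : B.functor ⟶ C.functor) :
    map₂ (A := A) (B := C) (γ ≫ δ) = map₂ γ ≫ map₂ δ
  map₂_add {K L : Type u} [Group K] [Group L] {A B : RepFunctor k K L}
    (γ δ : A.functor ⟶ B.functor) : map₂ (γ + δ) = map₂ γ + map₂ δ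
  mapComp_whiskerRight {J K L : Type u} [Group J] [Group K] [Group L] {A B : RepFunctor k J K}
    (γ : A.functor ⟶ B.functor) (C : RepFunctor k K L) (V : Cat J) :
    (map C).map ((map₂ γ).app V) ≫ (mapComp B C).hom.app V =
      (mapComp A C).hom.app V ≫
        (map₂ (A := A.comp C) (B := B.comp C) (Functor.whiskerRight γ C.functor)).app V
  mapComp_whiskerLeft {J K L : Type u} [Group J] [Group K] [Group L] (A : RepFunctor k J K)
    {B C : RepFunctor k K L} (γ : B.functor ⟶ C.functor) (V : Cat J) :
    (map₂ γ).app ((map A).obj V) ≫ (mapComp A C).hom.app V =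
      (mapComp A B).hom.app V ≫
        (map₂ (A := A.comp B) (B := A.comp C) (Functor.whiskerLeft A.functor γ)).app V
  mapComp_assoc {I J K L : Type u} [Group I] [Group J] [Group K] [Group L] (A : RepFunctor k I J)
    (B : RepFunctor k J K) (C : RepFunctor k K L) (V : Cat I) :
    (map C).map ((mapComp A B).hom.app V) ≫ (mapComp (A.comp B) C).hom.app V ≫
      (map₂ (A := (A.comp B).comp C) (B := A.comp (B.comp C))
        (Functor.associator A.functor B.functor C.functor).hom).app V =
      (mapComp B C).hom.app ((map A).obj V) ≫ (mapComp A (B.comp C)).hom.app V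
  mapComp_id {K L : Type u} [Group K] [Group L] (A : RepFunctor k K L) (V : Cat K) :
    (mapId L).hom.app ((map A).obj V) ≫ (mapComp A (.id k L)).hom.app V ≫
      (map₂ (A := A.comp (RepFunctor.id k L)) (B := A) A.functor.rightUnitor.hom).app V = 𝟙 _
  weaklyIdempotentComplete (K : Type u) [Group K] : IsWeaklyIdempotentComplete (Cat K)

attribute [instance] RepSystem.cat RepSystem.preadditive RepSystem.map_additive

namespace RepSystem

variable {k : Type u} [CommRing k] (T : RepSystem.{u, a, b} k)
variable {K L : Type u} [Group K] [Group L]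

/-- The isomorphism induced by an isomorphism of functors. -/
@[simps hom]
def mapIso {A B : RepFunctor k K L} (e : A.functor ≅ B.functor) : T.map A ≅ T.map B where
  hom := T.map₂ e.hom
  inv := T.map₂ e.inv
  hom_inv_id := by rw [← T.map₂_comp, e.hom_inv_id, T.map₂_id]
  inv_hom_id := by rw [← T.map₂_comp, e.inv_hom_id, T.map₂_id]

/-- The underlying system of categories and restriction functors. -/
def toResSystem : ResSystem.{u, a, b} where
  Cat K _ := T.Cat K
  res φ hφ := T.map (RepFunctor.res k φ hφ)
  resComp ψ hψ φ hφ χ hχ h :=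
    T.mapComp (RepFunctor.res k φ hφ) (RepFunctor.res k ψ hψ) ≪≫
      T.mapIso (A := (RepFunctor.res k φ hφ).comp (RepFunctor.res k ψ hψ))
        (B := RepFunctor.res k χ hχ) (PlainRep.resCompIso ψ φ χ h)
  twist φ hφ ψ hψ l h :=
    T.mapIso (A := RepFunctor.res k φ hφ) (B := RepFunctor.res k ψ hψ)
      (PlainRep.twistIso φ ψ l h)

end RepSystem

/-! ### The three systems -/

/-- Plain representations as a `RepSystem`. -/
def plainRepSystem (k : Type u) [CommRing k] : RepSystem.{u, u + 1, u} k where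
  Cat K _ := Rep.{u} k K
  map A := A.functor
  map₂ γ := γ
  mapComp _ _ := Iso.refl _
  mapId _ := Iso.refl _
  map₂_id _ := rfl
  map₂_comp _ _ := rfl
  map₂_add _ _ := rfl
  mapComp_whiskerRight _ _ _ := by simp
  mapComp_whiskerLeft _ _ _ _ := by simp
  mapComp_assoc _ _ _ _ := by simp
  mapComp_id _ _ := by simp
  weaklyIdempotentComplete K _ := isWeaklyIdempotentComplete_of_isIdempotentComplete (Rep.{u} k K)

theorem plainRepSystem_toResSystem (k : Type u) [CommRing k] :
    (plainRepSystem k).toResSystem = plainSystem k := rfl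

namespace StableRep

section

variable (k : Type u) [CommRing k] (K : Type u) [Group K]

/-- The projection from representations to the stable category. -/
abbrev proj : Rep.{u} k K ⥤ StableRep k K := CategoryTheory.Quotient.functor (stableRel k K)

variable {k K} in
theorem stableRel_add ⦃X Y : Rep.{u} k K⦄ (f₁ f₂ g₁ g₂ : X ⟶ Y) (hf : stableRel k K f₁ f₂)
    (hg : stableRel k K g₁ g₂) : stableRel k K (f₁ + g₁) (f₂ + g₂) := by
  obtain ⟨P, i, q, hP, h⟩ := hf
  obtain ⟨P', i', q', hP', h'⟩ := hg
  refine ⟨P ⊞ P', biprod.lift i i', biprod.desc q q', inferInstance, ?_⟩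
  rw [biprod.lift_desc, ← h, ← h', add_sub_add_comm]

instance : Preadditive (StableRep k K) := CategoryTheory.Quotient.preadditive _ stableRel_add

instance : (proj k K).Additive := CategoryTheory.Quotient.functor_additive _ stableRel_add

end

variable {k : Type u} [CommRing k] {K L : Type u} [Group K] [Group L]

theorem proj_map_comp_map_eq_zero {X P Y : Rep.{u} k K} [Projective P] (i : X ⟶ P) (q : P ⟶ Y) :
    (proj k K).map i ≫ (proj k K).map q = 0 := by
  rw [← Functor.map_comp, ← (proj k K).map_zero]
  exact CategoryTheory.Quotient.sound _ ⟨P, i, q, inferInstance, sub_zero _⟩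

theorem proj_map_fst_comp_map_inl (Y P : Rep.{u} k K) [Projective P] :
    (proj k K).map (biprod.fst : Y ⊞ P ⟶ Y) ≫ (proj k K).map biprod.inl = 𝟙 _ := by
  have h := congrArg (proj k K).map (biprod.total (X := Y) (Y := P))
  rwa [Functor.map_add, Functor.map_comp, Functor.map_comp,
    proj_map_comp_map_eq_zero (P := P), add_zero, (proj k K).map_id] at h

/- A stable retraction of `f : X ⟶ Y` becomes an honest one after adding to `Y` a projective
representation. -/
variable (k K) in
theorem isWeaklyIdempotentComplete : IsWeaklyIdempotentComplete (StableRep k K) := by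
  rintro ⟨X⟩ ⟨Y⟩ f r h
  obtain ⟨f, rfl⟩ := (proj k K).map_surjective (X := X) (Y := Y) f
  obtain ⟨r, rfl⟩ := (proj k K).map_surjective (X := Y) (Y := X) r
  replace h : (proj k K).map (f ≫ r) = (proj k K).map (𝟙 X) :=
    ((proj k K).map_comp f r).trans (h.trans ((proj k K).map_id X).symm)
  obtain ⟨P, i, q, hP, h⟩ := (CategoryTheory.Quotient.functor_map_eq_iff _ _ _).1 h
  let f' : X ⟶ Y ⊞ P := biprod.lift f (-i)
  let r' : Y ⊞ P ⟶ X := biprod.desc r q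
  have hfr' : f' ≫ r' = 𝟙 X := by
    simp only [f', r', biprod.lift_desc, Preadditive.neg_comp, ← h, neg_sub, add_sub_cancel]
  obtain ⟨Z, j, p, hjp, hpj⟩ :=
    isWeaklyIdempotentComplete_of_isIdempotentComplete (Rep.{u} k K) f' r' hfr'
  refine ⟨(proj k K).obj Z, (proj k K).map (j ≫ biprod.fst), (proj k K).map (biprod.inl ≫ p),
    ?_, ?_⟩
  · rw [Functor.map_comp, Functor.map_comp, Category.assoc,
      reassoc_of% proj_map_fst_comp_map_inl, ← Functor.map_comp, hjp,
      (proj k K).map_id]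
  · have hYf : (biprod.inl ≫ p) ≫ j ≫ biprod.fst = 𝟙 Y - r ≫ f := by
      rw [Category.assoc, reassoc_of% hpj]
      simp [f', r']
    rw [← Functor.map_comp, hYf, Functor.map_sub, (proj k K).map_id, Functor.map_comp]
    rfl

/-- The functor induced on stable categories. -/
def map (A : RepFunctor k K L) : StableRep k K ⥤ StableRep k L :=
  CategoryTheory.Quotient.lift _ (A.functor ⋙ proj k L) (by
    rintro X Y f g ⟨P, i, q, hP, h⟩
    refine CategoryTheory.Quotient.sound _
      ⟨A.functor.obj P, A.functor.map i, A.functor.map q, inferInstance, ?_⟩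
    rw [← Functor.map_sub, h, Functor.map_comp])

instance (A : RepFunctor k K L) : (map A).Additive where
  map_add {X Y f g} := by
    obtain ⟨f, rfl⟩ := (proj k K).map_surjective (X := X.as) (Y := Y.as) f
    obtain ⟨g, rfl⟩ := (proj k K).map_surjective (X := X.as) (Y := Y.as) g
    exact congrArg (proj k L).map (A.functor.map_add (f := f) (g := g))

/-- The natural transformation induced on stable categories. -/
def map₂ {A B : RepFunctor k K L} (γ : A.functor ⟶ B.functor) : map A ⟶ map B :=
  CategoryTheory.Quotient.natTransLift _
    (Functor.whiskerRight γ (proj k L) : proj k K ⋙ map A ⟶ proj k K ⋙ map B)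

end StableRep

/-- Stable categories as a `RepSystem`. -/
def stableRepSystem (k : Type u) [CommRing k] : RepSystem.{u, u + 1, u} k where
  Cat K _ := StableRep k K
  map A := StableRep.map A
  map₂ γ := StableRep.map₂ γ
  mapComp A B := CategoryTheory.Quotient.natIsoLift _ (Iso.refl _)
  mapId _ := CategoryTheory.Quotient.natIsoLift _ (Iso.refl _)
  map₂_id A := by
    ext ⟨X⟩
    exact (StableRep.proj k _).map_id _
  map₂_comp γ δ := by
    ext ⟨X⟩
    exact (StableRep.proj k _).map_comp _ _
  map₂_add γ δ := rfl
  mapComp_whiskerRight γ C V :=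
    congrArg (StableRep.proj k _).map
      (by simp : C.functor.map (γ.app V.as) ≫ 𝟙 _ = 𝟙 _ ≫ C.functor.map (γ.app V.as))
  mapComp_whiskerLeft A _ _ γ V :=
    congrArg (StableRep.proj k _).map
      (by simp : γ.app (A.functor.obj V.as) ≫ 𝟙 _ = 𝟙 _ ≫ γ.app (A.functor.obj V.as))
  mapComp_assoc A B C V :=
    congrArg (StableRep.proj k _).map
      (by simp : C.functor.map (𝟙 (B.functor.obj (A.functor.obj V.as))) ≫ 𝟙 _ ≫ 𝟙 _ = 𝟙 _ ≫ 𝟙 _)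
  mapComp_id A V :=
    congrArg (StableRep.proj k _).map
      (by simp : 𝟙 (A.functor.obj V.as) ≫ 𝟙 _ ≫ 𝟙 _ = 𝟙 _)
  weaklyIdempotentComplete := StableRep.isWeaklyIdempotentComplete k

theorem stableRepSystem_toResSystem (k : Type u) [Field k] :
    (stableRepSystem k).toResSystem = stableSystem k := rfl

section Derived

attribute [local instance] HasDerivedCategory.standard

variable {A B C D : Type (u + 1)} [Category.{u} A] [Category.{u} B] [Category.{u} C]
  [Category.{u} D] [Abelian A] [Abelian B] [Abelian C] [Abelian D]

theorem derivedCategory_natTrans_ext {E : Type*} [Category E] {F F' : DerivedCategory A ⥤ E}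
    {α β : F ⟶ F'}
    (h : ∀ X, α.app (DerivedCategory.Q.obj X) = β.app (DerivedCategory.Q.obj X)) : α = β :=
  Localization.natTrans_ext DerivedCategory.Q
    (HomologicalComplex.quasiIso A (ComplexShape.up ℤ)) h

variable {F F' : A ⥤ B} {G G' : B ⥤ C} {H : C ⥤ D}
  [F.Additive] [PreservesFiniteLimits F] [PreservesFiniteColimits F]
  [F'.Additive] [PreservesFiniteLimits F'] [PreservesFiniteColimits F']
  [G.Additive] [PreservesFiniteLimits G] [PreservesFiniteColimits G]
  [G'.Additive] [PreservesFiniteLimits G'] [PreservesFiniteColimits G']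
  [H.Additive] [PreservesFiniteLimits H] [PreservesFiniteColimits H]

variable (F) in
/-- The functor induced on derived categories is computed degreewise. -/
def derivedObjIso (X : CochainComplex A ℤ) :
    F.mapDerivedCategory.obj (DerivedCategory.Q.obj X) ≅
      DerivedCategory.Q.obj ((F.mapHomologicalComplex (ComplexShape.up ℤ)).obj X) :=
  F.mapDerivedCategoryFactors.app X

variable (F G) in
/-- `derivedObjIso` for a composite, with the composite applied in two steps. -/
def derivedObjIsoComp (X : CochainComplex A ℤ) :
    (F ⋙ G).mapDerivedCategory.obj (DerivedCategory.Q.obj X) ≅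
      DerivedCategory.Q.obj ((G.mapHomologicalComplex (ComplexShape.up ℤ)).obj
        ((F.mapHomologicalComplex (ComplexShape.up ℤ)).obj X)) :=
  derivedObjIso (F ⋙ G) X

theorem derivedObjIso_naturality {X Y : CochainComplex A ℤ} (f : X ⟶ Y) :
    F.mapDerivedCategory.map (DerivedCategory.Q.map f) ≫ (derivedObjIso F Y).hom =
      (derivedObjIso F X).hom ≫
        DerivedCategory.Q.map ((F.mapHomologicalComplex (ComplexShape.up ℤ)).map f) :=
  F.mapDerivedCategoryFactors_hom_naturality f

/-- A natural transformation of exact functors induces, degreewise on complexes, a natural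
transformation of the functors induced on derived categories. -/
def derivedMap₂ (γ : F ⟶ F') : F.mapDerivedCategory ⟶ F'.mapDerivedCategory :=
  Localization.liftNatTrans DerivedCategory.Q
    (HomologicalComplex.quasiIso A (ComplexShape.up ℤ))
    (F.mapHomologicalComplex (ComplexShape.up ℤ) ⋙ DerivedCategory.Q)
    (F'.mapHomologicalComplex (ComplexShape.up ℤ) ⋙ DerivedCategory.Q)
    F.mapDerivedCategory F'.mapDerivedCategory
    (Functor.whiskerRight (NatTrans.mapHomologicalComplex γ _) DerivedCategory.Q)

theorem derivedMap₂_app (γ : F ⟶ F') (X : CochainComplex A ℤ) :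
    (derivedMap₂ γ).app (DerivedCategory.Q.obj X) =
      (derivedObjIso F X).hom ≫
        DerivedCategory.Q.map ((NatTrans.mapHomologicalComplex γ _).app X) ≫
          (derivedObjIso F' X).inv :=
  Localization.liftNatTrans_app ..

theorem derivedMap₂_id : derivedMap₂ (𝟙 F) = 𝟙 F.mapDerivedCategory := by
  refine derivedCategory_natTrans_ext fun X ↦ ?_
  rw [derivedMap₂_app]
  simp

theorem derivedMap₂_comp {F'' : A ⥤ B} [F''.Additive] [PreservesFiniteLimits F'']
    [PreservesFiniteColimits F''] (γ : F ⟶ F') (δ : F' ⟶ F'') :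
    derivedMap₂ (γ ≫ δ) = derivedMap₂ γ ≫ derivedMap₂ δ := by
  refine derivedCategory_natTrans_ext fun X ↦ ?_
  rw [NatTrans.comp_app, derivedMap₂_app, derivedMap₂_app, derivedMap₂_app]
  simp

theorem derivedMap₂_add (γ δ : F ⟶ F') :
    derivedMap₂ (γ + δ) = derivedMap₂ γ + derivedMap₂ δ := by
  refine derivedCategory_natTrans_ext fun X ↦ ?_
  have h : (NatTrans.mapHomologicalComplex (γ + δ) (ComplexShape.up ℤ)).app X =
      (NatTrans.mapHomologicalComplex γ (ComplexShape.up ℤ)).app X +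
        (NatTrans.mapHomologicalComplex δ (ComplexShape.up ℤ)).app X := rfl
  rw [NatTrans.app_add, derivedMap₂_app, derivedMap₂_app, derivedMap₂_app, h, Functor.map_add]
  simp

theorem derivedMap₂_whiskerRight_app (γ : F ⟶ F') (X : CochainComplex A ℤ) :
    (derivedMap₂ (Functor.whiskerRight γ G)).app (DerivedCategory.Q.obj X) =
      (derivedObjIsoComp F G X).hom ≫ DerivedCategory.Q.map
        ((G.mapHomologicalComplex _).map ((NatTrans.mapHomologicalComplex γ _).app X)) ≫
          (derivedObjIsoComp F' G X).inv :=
  derivedMap₂_app _ _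

theorem derivedMap₂_whiskerLeft_app (γ : G ⟶ G') (X : CochainComplex A ℤ) :
    (derivedMap₂ (Functor.whiskerLeft F γ)).app (DerivedCategory.Q.obj X) =
      (derivedObjIsoComp F G X).hom ≫ DerivedCategory.Q.map
        ((NatTrans.mapHomologicalComplex γ _).app ((F.mapHomologicalComplex _).obj X)) ≫
          (derivedObjIsoComp F G' X).inv :=
  derivedMap₂_app _ _

variable (F G) in
theorem derivedCompIso_hom_app (X : CochainComplex A ℤ) :
    (derivedCompIso F G).hom.app (DerivedCategory.Q.obj X) =
      G.mapDerivedCategory.map (derivedObjIso F X).hom ≫ (derivedObjIso G _).hom ≫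
        (derivedObjIsoComp F G X).inv := by
  let _ : Localization.Lifting DerivedCategory.Q
      (HomologicalComplex.quasiIso A (ComplexShape.up ℤ))
      ((F ⋙ G).mapHomologicalComplex (ComplexShape.up ℤ) ⋙ DerivedCategory.Q)
      (F.mapDerivedCategory ⋙ G.mapDerivedCategory) :=
    ⟨(Functor.associator _ _ _).symm ≪≫
      Functor.isoWhiskerRight F.mapDerivedCategoryFactors G.mapDerivedCategory ≪≫
      Functor.associator _ _ _ ≪≫
      Functor.isoWhiskerLeft _ G.mapDerivedCategoryFactors ≪≫
      (Functor.associator _ _ _).symm ≪≫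
      Functor.isoWhiskerRight
        (Functor.mapHomologicalComplexCompIso (Iso.refl (F ⋙ G)) _) DerivedCategory.Q⟩
  refine (Localization.liftNatTrans_app DerivedCategory.Q
    (HomologicalComplex.quasiIso A (ComplexShape.up ℤ))
    ((F ⋙ G).mapHomologicalComplex (ComplexShape.up ℤ) ⋙ DerivedCategory.Q)
    ((F ⋙ G).mapHomologicalComplex (ComplexShape.up ℤ) ⋙ DerivedCategory.Q)
    (F.mapDerivedCategory ⋙ G.mapDerivedCategory) (F ⋙ G).mapDerivedCategory (𝟙 _) X).trans ?_
  have h : DerivedCategory.Q.map ((Functor.mapHomologicalComplexCompIso (Iso.refl (F ⋙ G))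
      (ComplexShape.up ℤ)).hom.app X) = 𝟙 _ := DerivedCategory.Q.map_id _
  change (𝟙 _ ≫ G.mapDerivedCategory.map (derivedObjIso F X).hom ≫ 𝟙 _ ≫
    (derivedObjIso G _).hom ≫ 𝟙 _ ≫ DerivedCategory.Q.map
      ((Functor.mapHomologicalComplexCompIso (Iso.refl (F ⋙ G)) _).hom.app X)) ≫ 𝟙 _ ≫
        (derivedObjIsoComp F G X).inv = _
  rw [h]
  simp only [Category.id_comp, Category.assoc]
  congr 2
  exact (Category.assoc _ _ _).trans ((Category.id_comp _).trans
    ((Category.id_comp _).trans (Category.id_comp _)))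

variable (A) in
/-- The identity functor induces a functor isomorphic to the identity on derived categories. -/
def derivedIdIso : 𝟭 (DerivedCategory A) ≅ (𝟭 A).mapDerivedCategory :=
  Localization.liftNatIso DerivedCategory.Q
    (HomologicalComplex.quasiIso A (ComplexShape.up ℤ))
    DerivedCategory.Q ((𝟭 A).mapHomologicalComplex (ComplexShape.up ℤ) ⋙ DerivedCategory.Q)
    (𝟭 (DerivedCategory A)) (𝟭 A).mapDerivedCategory
    (Functor.isoWhiskerRight (Functor.mapHomologicalComplexIdIso A _).symm DerivedCategory.Q)

theorem derivedIdIso_hom_app (X : CochainComplex A ℤ) :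
    (derivedIdIso A).hom.app (DerivedCategory.Q.obj X) = (derivedObjIso (𝟭 A) X).inv := by
  refine (Localization.liftNatTrans_app DerivedCategory.Q
    (HomologicalComplex.quasiIso A (ComplexShape.up ℤ)) DerivedCategory.Q
    ((𝟭 A).mapHomologicalComplex _ ⋙ DerivedCategory.Q) (𝟭 (DerivedCategory A))
    (𝟭 A).mapDerivedCategory _ X).trans ?_
  have h : DerivedCategory.Q.map ((Functor.mapHomologicalComplexIdIso A
      (ComplexShape.up ℤ)).inv.app X) = 𝟙 _ := DerivedCategory.Q.map_id _
  change 𝟙 _ ≫ DerivedCategory.Q.map ((Functor.mapHomologicalComplexIdIso A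
      (ComplexShape.up ℤ)).inv.app X) ≫ (derivedObjIso (𝟭 A) X).inv = _
  rw [h]
  exact (Category.id_comp _).trans (Category.id_comp _)

theorem derivedCompIso_whiskerRight (γ : F ⟶ F') :
    Functor.whiskerRight (derivedMap₂ γ) G.mapDerivedCategory ≫ (derivedCompIso F' G).hom =
      (derivedCompIso F G).hom ≫ derivedMap₂ (Functor.whiskerRight γ G) := by
  refine derivedCategory_natTrans_ext fun X ↦ ?_
  rw [NatTrans.comp_app, NatTrans.comp_app, Functor.whiskerRight_app,
    derivedMap₂_whiskerRight_app, derivedMap₂_app, derivedCompIso_hom_app, derivedCompIso_hom_app]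
  dsimp only [Functor.comp_obj]
  simp only [Functor.map_comp, Category.assoc, Iso.inv_hom_id_assoc, Iso.map_inv_hom_id_assoc,
    reassoc_of% derivedObjIso_naturality]

theorem derivedCompIso_whiskerLeft (γ : G ⟶ G') :
    Functor.whiskerLeft F.mapDerivedCategory (derivedMap₂ γ) ≫ (derivedCompIso F G').hom =
      (derivedCompIso F G).hom ≫ derivedMap₂ (Functor.whiskerLeft F γ) := by
  refine derivedCategory_natTrans_ext fun X ↦ ?_
  rw [NatTrans.comp_app, NatTrans.comp_app, Functor.whiskerLeft_app,
    derivedMap₂_whiskerLeft_app, derivedCompIso_hom_app, derivedCompIso_hom_app]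
  dsimp only [Functor.comp_obj]
  simp only [← NatTrans.naturality_assoc, derivedMap₂_app, Category.assoc, Iso.inv_hom_id_assoc]

section Associator

variable (F G H) (X : CochainComplex A ℤ)

/-- `derivedObjIso` for a left-bracketed triple composite, with the composite applied in three
steps. -/
def derivedObjIsoCompLeft : ((F ⋙ G) ⋙ H).mapDerivedCategory.obj (DerivedCategory.Q.obj X) ≅
    DerivedCategory.Q.obj ((H.mapHomologicalComplex (ComplexShape.up ℤ)).obj
      ((G.mapHomologicalComplex (ComplexShape.up ℤ)).obj
        ((F.mapHomologicalComplex (ComplexShape.up ℤ)).obj X))) :=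
  derivedObjIso ((F ⋙ G) ⋙ H) X

/-- `derivedObjIso` for a right-bracketed triple composite, with the composite applied in three
steps. -/
def derivedObjIsoCompRight : (F ⋙ G ⋙ H).mapDerivedCategory.obj (DerivedCategory.Q.obj X) ≅
    DerivedCategory.Q.obj ((H.mapHomologicalComplex (ComplexShape.up ℤ)).obj
      ((G.mapHomologicalComplex (ComplexShape.up ℤ)).obj
        ((F.mapHomologicalComplex (ComplexShape.up ℤ)).obj X))) :=
  derivedObjIso (F ⋙ G ⋙ H) X

theorem derivedMap₂_associator_hom_app :
    (derivedMap₂ (Functor.associator F G H).hom).app (DerivedCategory.Q.obj X) =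
      (derivedObjIsoCompLeft F G H X).hom ≫ (derivedObjIsoCompRight F G H X).inv := by
  refine (derivedMap₂_app _ _).trans ?_
  have h : DerivedCategory.Q.map ((NatTrans.mapHomologicalComplex (F.associator G H).hom
      (ComplexShape.up ℤ)).app X) = 𝟙 _ := DerivedCategory.Q.map_id _
  rw [h]
  exact congrArg ((derivedObjIsoCompLeft F G H X).hom ≫ ·) (Category.id_comp _)

theorem derivedCompIso_comp_left_hom_app :
    (derivedCompIso (F ⋙ G) H).hom.app (DerivedCategory.Q.obj X) =
      H.mapDerivedCategory.map (derivedObjIsoComp F G X).hom ≫ (derivedObjIso H _).hom ≫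
        (derivedObjIsoCompLeft F G H X).inv :=
  derivedCompIso_hom_app _ _ _

theorem derivedCompIso_comp_right_hom_app :
    (derivedCompIso F (G ⋙ H)).hom.app (DerivedCategory.Q.obj X) =
      (G ⋙ H).mapDerivedCategory.map (derivedObjIso F X).hom ≫ (derivedObjIsoComp G H _).hom ≫
        (derivedObjIsoCompRight F G H X).inv :=
  derivedCompIso_hom_app _ _ _

theorem derivedCompIso_assoc :
    Functor.whiskerRight (derivedCompIso F G).hom H.mapDerivedCategory ≫
        (derivedCompIso (F ⋙ G) H).hom ≫ derivedMap₂ (Functor.associator F G H).hom =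
      (Functor.associator _ _ _).hom ≫
        Functor.whiskerLeft F.mapDerivedCategory (derivedCompIso G H).hom ≫
          (derivedCompIso F (G ⋙ H)).hom := by
  refine derivedCategory_natTrans_ext fun X ↦ ?_
  rw [NatTrans.comp_app, NatTrans.comp_app, NatTrans.comp_app, NatTrans.comp_app,
    Functor.whiskerLeft_app, Functor.whiskerRight_app, Functor.associator_hom_app,
    derivedCompIso_hom_app, derivedMap₂_associator_hom_app, derivedCompIso_comp_left_hom_app,
    derivedCompIso_comp_right_hom_app]
  dsimp only [Functor.comp_obj]
  rw [Category.id_comp, ← NatTrans.naturality_assoc, derivedCompIso_hom_app]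
  simp

end Associator

section RightUnitor

variable (F)

/-- `derivedObjIso` for `F ⋙ 𝟭 B`, with the identity functor discarded. -/
def derivedObjIsoCompId (X : CochainComplex A ℤ) :
    (F ⋙ 𝟭 B).mapDerivedCategory.obj (DerivedCategory.Q.obj X) ≅
      DerivedCategory.Q.obj ((F.mapHomologicalComplex (ComplexShape.up ℤ)).obj X) :=
  derivedObjIso (F ⋙ 𝟭 B) X

variable (B) in
/-- `derivedObjIso` for `𝟭 B`, with the identity functor discarded. -/
def derivedObjIsoId (Y : CochainComplex B ℤ) :
    (𝟭 B).mapDerivedCategory.obj (DerivedCategory.Q.obj Y) ≅ DerivedCategory.Q.obj Y :=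
  derivedObjIso (𝟭 B) Y

theorem derivedMap₂_rightUnitor_hom_app (X : CochainComplex A ℤ) :
    (derivedMap₂ F.rightUnitor.hom).app (DerivedCategory.Q.obj X) =
      (derivedObjIsoCompId F X).hom ≫ (derivedObjIso F X).inv := by
  refine (derivedMap₂_app _ _).trans ?_
  have h : DerivedCategory.Q.map ((NatTrans.mapHomologicalComplex F.rightUnitor.hom
      (ComplexShape.up ℤ)).app X) = 𝟙 _ := DerivedCategory.Q.map_id _
  rw [h]
  exact congrArg ((derivedObjIsoCompId F X).hom ≫ ·) (Category.id_comp _)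

theorem derivedCompIso_comp_id_hom_app (X : CochainComplex A ℤ) :
    (derivedCompIso F (𝟭 B)).hom.app (DerivedCategory.Q.obj X) =
      (𝟭 B).mapDerivedCategory.map (derivedObjIso F X).hom ≫ (derivedObjIsoId B _).hom ≫
        (derivedObjIsoCompId F X).inv :=
  derivedCompIso_hom_app _ _ _

theorem derivedCompIso_id :
    Functor.whiskerLeft F.mapDerivedCategory (derivedIdIso B).hom ≫
      (derivedCompIso F (𝟭 B)).hom ≫ derivedMap₂ F.rightUnitor.hom = 𝟙 F.mapDerivedCategory := by
  refine derivedCategory_natTrans_ext fun X ↦ ?_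
  have h : (derivedIdIso B).hom.app (DerivedCategory.Q.obj
      ((F.mapHomologicalComplex (ComplexShape.up ℤ)).obj X)) = (derivedObjIsoId B _).inv :=
    derivedIdIso_hom_app _
  rw [NatTrans.comp_app, NatTrans.comp_app, Functor.whiskerLeft_app,
    derivedMap₂_rightUnitor_hom_app, derivedCompIso_comp_id_hom_app]
  dsimp only [Functor.comp_obj, Functor.id_obj]
  rw [Category.assoc, ← NatTrans.naturality_assoc, h]
  simp

end RightUnitor

/-- Derived categories as a `RepSystem`. -/
def derivedRepSystem (k : Type u) [CommRing k] : RepSystem.{u, u + 1, u + 1} k where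
  Cat K _ := DerivedCategory (Rep.{u} k K)
  map A := A.functor.mapDerivedCategory
  map_additive _ := inferInstance
  map₂ γ := derivedMap₂ γ
  mapComp A B := derivedCompIso A.functor B.functor
  mapId K _ := derivedIdIso (Rep.{u} k K)
  map₂_id _ := derivedMap₂_id
  map₂_comp := derivedMap₂_comp
  map₂_add := derivedMap₂_add
  mapComp_whiskerRight γ _ V := congr_app (derivedCompIso_whiskerRight γ) V
  mapComp_whiskerLeft _ _ _ γ V := congr_app (derivedCompIso_whiskerLeft γ) V
  mapComp_assoc A B C V :=
    (congr_app (derivedCompIso_assoc A.functor B.functor C.functor) V).trans (Category.id_comp _)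
  mapComp_id A V := congr_app (derivedCompIso_id A.functor) V
  weaklyIdempotentComplete K _ :=
    isWeaklyIdempotentComplete_of_pretriangulated (DerivedCategory (Rep.{u} k K))

theorem derivedRepSystem_toResSystem (k : Type u) [CommRing k] :
    (derivedRepSystem k).toResSystem = derivedSystem k := rfl

end Derived

/-! ### Coherence -/

namespace RepSystem

variable {k : Type u} [CommRing k] {T : RepSystem.{u, a, b} k}
variable {J K L M : Type u} [Group J] [Group K] [Group L] [Group M]

/-- A presentation of `Y` as the value at `V` of an induced functor. The instances below present
every object obtained from `V` by applying induced functors; a coherence statement between such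
objects is thereby reduced to one about natural transformations of functors of representations. -/
class Presentation (V : T.Cat K) (Y : T.Cat L) where
  /-- the presenting functor -/
  functor : RepFunctor k K L
  /-- the presentation -/
  iso : Y ≅ (T.map functor).obj V

instance (V : T.Cat K) : Presentation V V := ⟨.id k K, (T.mapId K).app V⟩

instance (V : T.Cat K) (Y : T.Cat L) [Presentation V Y] (A : RepFunctor k L M) :
    Presentation V ((T.map A).obj Y) :=
  ⟨(Presentation.functor V Y).comp A,
    (T.map A).mapIso (Presentation.iso (V := V)) ≪≫ (T.mapComp (Presentation.functor V Y) A).app V⟩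

/-- The morphism between presented objects induced by a natural transformation. -/
def induced (V : T.Cat K) {Y Y' : T.Cat L} [Presentation V Y] [Presentation V Y']
    (γ : (Presentation.functor V Y).functor ⟶ (Presentation.functor V Y').functor) : Y ⟶ Y' :=
  (Presentation.iso (V := V)).hom ≫ (T.map₂ γ).app V ≫ (Presentation.iso (V := V)).inv

section Induced

variable (V : T.Cat K) {Y Y' Y'' : T.Cat L}
variable [Presentation V Y] [Presentation V Y'] [Presentation V Y'']

theorem id_eq_induced : 𝟙 Y = induced V (𝟙 (Presentation.functor V Y).functor) := by
  simp [induced, T.map₂_id]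

theorem induced_comp (γ : (Presentation.functor V Y).functor ⟶ (Presentation.functor V Y').functor)
    (δ : (Presentation.functor V Y').functor ⟶ (Presentation.functor V Y'').functor) :
    induced V γ ≫ induced V δ = induced V (γ ≫ δ) := by
  simp [induced, T.map₂_comp]

theorem induced_add
    (γ δ : (Presentation.functor V Y).functor ⟶ (Presentation.functor V Y').functor) :
    induced V (γ + δ) = induced V γ + induced V δ := by
  simp [induced, T.map₂_add]

variable (Y Y') in
/-- `induced` as an additive homomorphism. -/
def inducedAddHom : ((Presentation.functor V Y).functor ⟶ (Presentation.functor V Y').functor) →+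
    (Y ⟶ Y') :=
  AddMonoidHom.mk' (induced V) (induced_add V)

theorem zero_eq_induced : (0 : Y ⟶ Y') = induced V 0 :=
  (map_zero (inducedAddHom V Y Y')).symm

theorem sum_induced {ι : Type*} (s : Finset ι)
    (γ : ι → ((Presentation.functor V Y).functor ⟶ (Presentation.functor V Y').functor)) :
    ∑ i ∈ s, induced V (γ i) = induced V (∑ i ∈ s, γ i) :=
  (map_sum (inducedAddHom V Y Y') γ s).symm

theorem map_induced (A : RepFunctor k L M)
    (γ : (Presentation.functor V Y).functor ⟶ (Presentation.functor V Y').functor) :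
    (T.map A).map (induced V γ) = induced V (Y := (T.map A).obj Y) (Y' := (T.map A).obj Y')
      (Functor.whiskerRight γ A.functor) := by
  simp only [induced, Functor.map_comp, Presentation.iso, Iso.trans_hom, Iso.trans_inv,
    Functor.mapIso_hom, Functor.mapIso_inv, Iso.app_hom, Iso.app_inv, Category.assoc]
  rw [← reassoc_of% T.mapComp_whiskerRight γ A V]
  simp

theorem map₂_app_eq_induced {A B : RepFunctor k L M} (γ : A.functor ⟶ B.functor) :
    (T.map₂ γ).app Y =
      induced V (Functor.whiskerLeft (Presentation.functor V Y).functor γ) := by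
  simp only [induced, Presentation.iso, Iso.trans_hom, Iso.trans_inv, Functor.mapIso_hom,
    Functor.mapIso_inv, Iso.app_hom, Iso.app_inv, Category.assoc]
  rw [← reassoc_of% T.mapComp_whiskerLeft (Presentation.functor V Y) γ V]
  simp

theorem mapComp_hom_app_eq_induced (A : RepFunctor k L M) (B : RepFunctor k M J) :
    (T.mapComp A B).hom.app Y = induced V (Y := (T.map B).obj ((T.map A).obj Y))
      (Functor.associator (Presentation.functor V Y).functor A.functor B.functor).hom := by
  have h := T.mapComp_assoc (Presentation.functor V Y) A B V
  have h' := (T.mapComp A B).hom.naturality (Presentation.iso (V := V) (Y := Y)).hom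
  dsimp only [Functor.comp_map, Functor.comp_obj] at h'
  simp only [induced, Presentation.iso, Iso.trans_hom, Iso.trans_inv, Functor.mapIso_hom,
    Functor.mapIso_inv, Iso.app_hom, Iso.app_inv, Category.assoc, Functor.map_comp,
    Presentation.functor]
  rw [reassoc_of% h, reassoc_of% h']
  simp

theorem mapComp_inv_app_eq_induced (A : RepFunctor k L M) (B : RepFunctor k M J) :
    (T.mapComp A B).inv.app Y = induced V (Y' := (T.map B).obj ((T.map A).obj Y))
      (Functor.associator (Presentation.functor V Y).functor A.functor B.functor).inv := by
  rw [← cancel_epi ((T.mapComp A B).hom.app Y), Iso.hom_inv_id_app, mapComp_hom_app_eq_induced V]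
  refine (id_eq_induced V (Y := (T.map B).obj ((T.map A).obj Y))).trans (Eq.trans ?_
    (induced_comp V (Y := (T.map B).obj ((T.map A).obj Y))
      (Y'' := (T.map B).obj ((T.map A).obj Y)) _ _).symm)
  rw [Iso.hom_inv_id]

theorem mapId_hom_app_eq_induced :
    (T.mapId L).hom.app Y = induced V (Y := Y) (Y' := (T.map (.id k L)).obj Y)
      (Functor.rightUnitor (Presentation.functor V Y).functor).inv := by
  set F := Presentation.functor V Y
  have h := T.mapComp_id F V
  have hF : (T.map₂ (A := F.comp (.id k L)) (B := F) F.functor.rightUnitor.hom).app V ≫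
      (T.map₂ (A := F) (B := F.comp (.id k L)) F.functor.rightUnitor.inv).app V = 𝟙 _ :=
    (T.mapIso (A := F.comp (.id k L)) (B := F) F.functor.rightUnitor).hom_inv_id_app V
  have hY := (T.mapId L).hom.naturality (Presentation.iso (V := V) (Y := Y)).hom
  dsimp only [Functor.id_map, Functor.id_obj] at hY h
  rw [induced, ← Category.assoc, Iso.eq_comp_inv]
  simp only [Presentation.iso, Iso.trans_hom, Functor.mapIso_hom, Iso.app_hom]
  rw [← reassoc_of% hY]
  congr 1
  simpa only [Category.assoc, hF, Category.id_comp, Category.comp_id] using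
    h =≫ (T.map₂ (A := F) (B := F.comp (.id k L)) F.functor.rightUnitor.inv).app V

theorem mapId_inv_app_eq_induced :
    (T.mapId L).inv.app Y = induced V (Y := (T.map (.id k L)).obj Y) (Y' := Y)
      (Functor.rightUnitor (Presentation.functor V Y).functor).hom := by
  rw [← cancel_epi ((T.mapId L).hom.app Y), Iso.hom_inv_id_app, mapId_hom_app_eq_induced V]
  refine (id_eq_induced V (Y := Y)).trans
    (Eq.trans ?_ (induced_comp V (Y := Y) (Y'' := Y) _ _).symm)
  rw [Iso.inv_hom_id]

end Induced

end RepSystem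

/-! ### Natural transformations between restriction and coinduction -/

namespace PlainRep

variable {k : Type u} [CommRing k] {J G : Type u} [Group J] [Group G]

variable (k G) in
/-- Restriction along the identity homomorphism is the identity functor. -/
def resIdIso : Rep.resFunctor.{u} (k := k) (MonoidHom.id G) ≅ 𝟭 _ :=
  NatIso.ofComponents fun _ ↦ Iso.refl _

section Apply

variable {H : Subgroup G} {W : Rep.{u} k H}

variable (W) in
/-- Evaluation at `y` of the functions in a coinduced representation, as a linear map. -/
def coindApply (y : G) : (Rep.coindFunctor.{u} k H.subtype).obj W →ₗ[k] W :=
  LinearMap.proj y ∘ₗ (Representation.coindV H.subtype W.ρ).subtype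

theorem coind_ext {φ φ' : (Rep.coindFunctor.{u} k H.subtype).obj W}
    (h : ∀ y, coindApply W y φ = coindApply W y φ') : φ = φ' :=
  Subtype.ext (funext h)

theorem coindApply_mul (h : H) (y : G) (φ : (Rep.coindFunctor.{u} k H.subtype).obj W) :
    coindApply W (h * y) φ = W.ρ h (coindApply W y φ) :=
  φ.2 h y

theorem coindApply_ρ (x y : G) (φ : (Rep.coindFunctor.{u} k H.subtype).obj W) :
    coindApply W y (((Rep.coindFunctor.{u} k H.subtype).obj W).ρ x φ) = coindApply W (y * x) φ :=
  rfl

variable (k) in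
/-- Evaluation at `g` of the functions in a coinduced representation, as a natural
transformation. -/
def coindEval (κ : J →* G) (β : J →* H) (g : G) (h : ∀ x, (β x : G) = g * κ x * g⁻¹) :
    Rep.coindFunctor.{u} k H.subtype ⋙ Rep.resFunctor.{u} (k := k) κ ⟶
      Rep.resFunctor.{u} (k := k) β where
  app W := Rep.ofHom ⟨coindApply W g, fun x ↦ by
    ext φ
    have hφ := coindApply_mul (β x) g φ
    rw [h, inv_mul_cancel_right] at hφ
    exact hφ⟩
  naturality _ _ _ := by ext; rfl

theorem resCoind_counit_apply (W : Rep.{u} k H) (φ : (Rep.coindFunctor.{u} k H.subtype).obj W) :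
    ((Rep.resCoindAdjunction.{u} k H.subtype).counit.app W).hom φ = coindApply W 1 φ :=
  rfl

end Apply

section Average

variable (H : Subgroup G) [H.FiniteIndex]

attribute [local instance] Subgroup.fintypeQuotientOfFiniteIndex

omit [H.FiniteIndex] in
theorem indRes_counit_mk (V : Rep.{u} k G) (x : G) (v : V) :
    ((Rep.indResAdjunction k H.subtype).counit.app V).hom
      (Representation.IndV.mk H.subtype (Rep.res H.subtype V).ρ x v) = V.ρ x⁻¹ v := by
  trans TensorProduct.lift ((Finsupp.lift (V →ₗ[k] V) k G fun y ↦ V.ρ y⁻¹) ∘ₗ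
    (MonoidAlgebra.coeffLinearEquiv k).toLinearMap) (TensorProduct.tmul k (.single x 1) v)
  · rfl
  · simp

open scoped Classical in
theorem coindRes_counit_apply (V : Rep.{u} k G)
    (φ : (Rep.coindFunctor.{u} k H.subtype).obj (Rep.res H.subtype V)) :
    ((Rep.coindResAdjunction.{u} k H).counit.app V).hom φ =
      ∑ q : Quotient (QuotientGroup.rightRel H),
        V.ρ q.out⁻¹ (coindApply (Rep.res H.subtype V) q.out φ) := by
  trans ((Rep.indResAdjunction k H.subtype).counit.app V).hom
    (Rep.coindToInd (Rep.res H.subtype V) φ)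
  · rfl
  rw [Rep.coindToInd_apply, map_sum]
  refine Finset.sum_congr rfl fun q _ ↦ ?_
  obtain ⟨x, hx⟩ : ∃ x, q.out = x := ⟨_, rfl⟩
  obtain rfl : q = Quotient.mk _ x := by rw [← hx, q.out_eq]
  rw [hx]
  exact indRes_counit_mk H V x _

open scoped Classical in
variable {H} in
/-- For `c` the inverse of the index of `H` in `k`, this is a retraction of the unit of the
adjunction between restriction and coinduction. -/
def average (c : k) :
    Rep.resFunctor.{u} (k := k) H.subtype ⋙ Rep.coindFunctor.{u} k H.subtype ⟶ 𝟭 _ :=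
  c • (Rep.coindResAdjunction.{u} k H).counit

theorem unit_average (c : k) (hc : c * H.index = 1) :
    (Rep.resCoindAdjunction.{u} k H.subtype).unit ≫ average c = 𝟙 _ := by
  classical
  ext V v
  trans c • ∑ q : Quotient (QuotientGroup.rightRel H), V.ρ q.out⁻¹ (V.ρ q.out v)
  · exact congrArg (c • ·) (coindRes_counit_apply H V _)
  have hcard : Fintype.card (Quotient (QuotientGroup.rightRel H)) = H.index := by
    rw [← Nat.card_eq_fintype_card, Subgroup.index,
      Nat.card_congr (QuotientGroup.quotientRightRelEquivQuotientLeftRel H)]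
  simp only [Representation.inv_self_apply, Finset.sum_const, Finset.card_univ, hcard,
    ← Nat.cast_smul_eq_nsmul k, smul_smul, hc, one_smul]
  rfl

end Average

section Mackey

variable (H : Subgroup G) (κ : J →* G) (g : G)

/-- The subgroup `κ⁻¹(g⁻¹ H g)`. -/
def mackeySubgroup : Subgroup J :=
  H.comap ((MulAut.conj g).toMonoidHom.comp κ)

instance [H.FiniteIndex] : (mackeySubgroup H κ g).FiniteIndex :=
  ⟨by
    rw [mackeySubgroup, Subgroup.index_comap]
    exact Subgroup.FiniteIndex.index_ne_zero (H := H.subgroupOf _)⟩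

/-- The homomorphism `x ↦ g κ(x) g⁻¹` from `κ⁻¹(g⁻¹ H g)` to `H`. -/
def mackeyHom : mackeySubgroup H κ g →* H :=
  ((MulAut.conj g).toMonoidHom.comp κ).subgroupComap H

open scoped Classical in
variable (k) in
/-- The vector `w` gives the function supported on `H g` with value `w` at `g`. -/
def single :
    Rep.resFunctor.{u} (k := k) (mackeyHom H κ g) ⟶
      (Rep.coindFunctor.{u} k H.subtype ⋙ Rep.resFunctor.{u} (k := k) κ) ⋙
        Rep.resFunctor.{u} (k := k) (mackeySubgroup H κ g).subtype where
  app W := Rep.ofHom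
    ⟨(Rep.indToCoindAux W g).codRestrict (Representation.coindV H.subtype W.ρ)
      fun w h y ↦ by simp, fun x ↦ by
        ext w
        refine Subtype.ext (funext fun y ↦ ?_)
        have hx : (mackeyHom H κ g x : G) * g = g * κ x := inv_mul_cancel_right _ _
        trans Rep.indToCoindAux W (mackeyHom H κ g x * g * κ x⁻¹) (W.ρ (mackeyHom H κ g x) w) y
        · rw [hx, map_inv, mul_inv_cancel_right]; rfl
        · rw [map_inv, Rep.indToCoindAux_fst_mul_inv, Rep.indToCoindAux_mul_fst]; rfl⟩
  naturality W W' f := by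
    ext w
    exact Subtype.ext (funext fun y ↦ Rep.indToCoindAux_comm f g y w)

open scoped Classical in
variable (k) in
/-- Extension by zero to `G` of functions on the double coset `H g κ(J)`. -/
def extendByZero [H.FiniteIndex] :
    Rep.resFunctor.{u} (k := k) (mackeyHom H κ g) ⋙
      Rep.coindFunctor.{u} k (mackeySubgroup H κ g).subtype ⟶
    Rep.coindFunctor.{u} k H.subtype ⋙ Rep.resFunctor.{u} (k := k) κ :=
  Functor.whiskerRight (single k H κ g) _ ≫ (Functor.associator _ _ _).hom ≫
    Functor.whiskerLeft _ (Rep.coindResAdjunction.{u} k (mackeySubgroup H κ g)).counit ≫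
      (Functor.rightUnitor _).hom

variable {H κ g} {W : Rep.{u} k H}

variable [H.FiniteIndex] (ψ : (Rep.coindFunctor.{u} k (mackeySubgroup H κ g).subtype).obj
  (Rep.res (mackeyHom H κ g) W))

open scoped Classical in
attribute [local instance] Subgroup.fintypeQuotientOfFiniteIndex in
theorem extendByZero_apply_eq_sum (y : G) :
    coindApply W y (((extendByZero k H κ g).app W).hom ψ) =
      ∑ q : Quotient (QuotientGroup.rightRel (mackeySubgroup H κ g)),
        Rep.indToCoindAux W (g * κ q.out)
          (coindApply (Rep.res (mackeyHom H κ g) W) q.out ψ) y := by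
  trans coindApply W y (∑ q : Quotient (QuotientGroup.rightRel (mackeySubgroup H κ g)),
    ((Rep.coindFunctor.{u} k H.subtype).obj W).ρ (κ q.out⁻¹)
      (((single k H κ g).app W).hom (coindApply (Rep.res (mackeyHom H κ g) W) q.out ψ)))
  · exact congrArg (coindApply W y) (coindRes_counit_apply (mackeySubgroup H κ g)
      ((Rep.coindFunctor.{u} k H.subtype ⋙ Rep.resFunctor.{u} (k := k) κ).obj W)
      (((Rep.coindFunctor k _).map ((single k H κ g).app W)).hom ψ))
  rw [map_sum]
  refine Finset.sum_congr rfl fun q _ ↦ ?_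
  rw [coindApply_ρ, map_inv]
  exact Rep.indToCoindAux_snd_mul_inv _ _ _ _

theorem extendByZero_apply_of_ne {y : G} (hy : ∀ (h : H) (x : J), h * g * κ x ≠ y) :
    coindApply W y (((extendByZero k H κ g).app W).hom ψ) = 0 := by
  classical
  rw [extendByZero_apply_eq_sum]
  refine Finset.sum_eq_zero fun q _ ↦ Rep.indToCoindAux_of_not_rel _ _ _ ?_
  rintro ⟨h, rfl⟩
  exact hy h q.out (mul_assoc _ _ _)

theorem extendByZero_apply_self :
    coindApply W g (((extendByZero k H κ g).app W).hom ψ) =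
      coindApply (Rep.res (mackeyHom H κ g) W) 1 ψ := by
  classical
  let M := mackeySubgroup H κ g
  let _ := Subgroup.fintypeQuotientOfFiniteIndex (H := M)
  have hM : (Quotient.mk (QuotientGroup.rightRel M) 1).out ∈ M := by
    have := QuotientGroup.rightRel_apply.1 (Quotient.mk_out (s := QuotientGroup.rightRel M) 1)
    rwa [one_mul, inv_mem_iff] at this
  rw [extendByZero_apply_eq_sum, Finset.sum_eq_single (Quotient.mk (QuotientGroup.rightRel M) 1)]
  · generalize (Quotient.mk (QuotientGroup.rightRel M) 1).out = m at hM
    have hψ : coindApply (Rep.res (mackeyHom H κ g) W) m ψ =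
        W.ρ (mackeyHom H κ g ⟨m, hM⟩) (coindApply (Rep.res (mackeyHom H κ g) W) 1 ψ) := by
      simpa using coindApply_mul (⟨m, hM⟩ : M) 1 ψ
    have hg : g * κ m = mackeyHom H κ g ⟨m, hM⟩ * g := (inv_mul_cancel_right _ _).symm
    rw [hψ, hg, Rep.indToCoindAux_mul_fst, Rep.indToCoindAux_self]
  · intro q _ hq
    refine Rep.indToCoindAux_of_not_rel _ _ _ ?_
    rw [QuotientGroup.rightRel_apply]
    intro hqH
    refine hq ?_
    rw [← q.out_eq]
    exact Quotient.sound (QuotientGroup.rightRel_apply.2 (by simpa [M, mackeySubgroup] using hqH))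
  · exact fun h ↦ absurd (Finset.mem_univ _) h

theorem extendByZero_apply_mul (h : H) (x : J) :
    coindApply W (h * g * κ x) (((extendByZero k H κ g).app W).hom ψ) =
      W.ρ h (coindApply (Rep.res (mackeyHom H κ g) W) x ψ) := by
  rw [mul_assoc, coindApply_mul, ← coindApply_ρ]
  congr 1
  refine (congrArg (coindApply W g)
    (Rep.hom_comm_apply ((extendByZero k H κ g).app W) x ψ)).symm.trans ?_
  rw [extendByZero_apply_self]
  exact congrArg (fun y ↦ coindApply (Rep.res (mackeyHom H κ g) W) y ψ) (one_mul x)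

variable (H κ g) in
theorem extendByZero_comp_coindEval (ι : mackeySubgroup H κ g →* G) (hι : ∀ x, ι x = κ x)
    (h : ∀ x, (mackeyHom H κ g x : G) = g * ι x * g⁻¹) (V : Rep.{u} k H) :
    (Rep.resFunctor (mackeySubgroup H κ g).subtype).map ((extendByZero k H κ g).app V) ≫
      (resCompIso (mackeySubgroup H κ g).subtype κ ι hι).hom.app _ ≫
        (coindEval k ι (mackeyHom H κ g) g h).app V =
      (Rep.resCoindAdjunction.{u} k (mackeySubgroup H κ g).subtype).counit.app
        ((Rep.resFunctor (mackeyHom H κ g)).obj V) := by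
  ext φ
  trans coindApply V g (((extendByZero k H κ g).app V).hom φ)
  · rfl
  · exact (extendByZero_apply_self φ).trans
      (resCoind_counit_apply ((Rep.resFunctor (mackeyHom H κ g)).obj V) φ).symm

variable (κ) in
theorem extendByZero_comp_coindEval_of_ne {g' : G} (hg : ∀ (h : H) (x : J), h * g * κ x ≠ g')
    (ι : mackeySubgroup H κ g' →* G) (hι : ∀ x, ι x = κ x)
    (h : ∀ x, (mackeyHom H κ g' x : G) = g' * ι x * g'⁻¹) (V : Rep.{u} k H) :
    (Rep.resFunctor (mackeySubgroup H κ g').subtype).map ((extendByZero k H κ g).app V) ≫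
      (resCompIso (mackeySubgroup H κ g').subtype κ ι hι).hom.app _ ≫
        (coindEval k ι (mackeyHom H κ g') g' h).app V = 0 := by
  ext φ
  trans coindApply V g' (((extendByZero k H κ g).app V).hom φ)
  · rfl
  · exact extendByZero_apply_of_ne φ hg

theorem sum_extendByZero [Fintype (DoubleCoset.Quotient (H : Set G) (κ.range : Set G))]
    (φ : (Rep.coindFunctor.{u} k H.subtype).obj W)
    (ψ : (g : G) → (Rep.coindFunctor.{u} k (mackeySubgroup H κ g).subtype).obj
      (Rep.res (mackeyHom H κ g) W))
    (hψ : ∀ g x, coindApply (Rep.res (mackeyHom H κ g) W) x (ψ g) = coindApply W (g * κ x) φ) :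
    ∑ q : DoubleCoset.Quotient (H : Set G) (κ.range : Set G),
      ((extendByZero k H κ q.out).app W).hom (ψ q.out) = φ := by
  classical
  refine coind_ext fun y ↦ ?_
  obtain ⟨h, _, hh, ⟨x, rfl⟩, hy⟩ := DoubleCoset.mk_out_eq_mul H κ.range y
  rw [map_sum, Finset.sum_eq_single (DoubleCoset.mk H κ.range y)]
  · generalize DoubleCoset.mk H κ.range y = q at hy
    obtain rfl : (⟨h, hh⟩⁻¹ : H) * q.out * κ x⁻¹ = y := by simp [hy, mul_assoc]
    rw [extendByZero_apply_mul, hψ, mul_assoc, coindApply_mul]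
  · intro q _ hq
    refine extendByZero_apply_of_ne _ ?_
    rintro h x rfl
    refine hq ?_
    rw [← DoubleCoset.out_eq' H κ.range q, DoubleCoset.eq]
    exact ⟨h, h.2, κ x, ⟨x, rfl⟩, by rw [DoubleCoset.out_eq']⟩
  · exact fun h ↦ absurd (Finset.mem_univ _) h

variable (H κ) in
theorem sum_unit_comp_extendByZero
    [Fintype (DoubleCoset.Quotient (H : Set G) (κ.range : Set G))]
    (ι : (g : G) → mackeySubgroup H κ g →* G) (hι : ∀ g x, ι g x = κ x)
    (h : ∀ g x, (mackeyHom H κ g x : G) = g * ι g x * g⁻¹) (V : Rep.{u} k H) :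
    ∑ q : DoubleCoset.Quotient (H : Set G) (κ.range : Set G),
      (Rep.resCoindAdjunction.{u} k (mackeySubgroup H κ q.out).subtype).unit.app
          ((Rep.resFunctor κ).obj ((Rep.coindFunctor.{u} k H.subtype).obj V)) ≫
        (Rep.coindFunctor.{u} k (mackeySubgroup H κ q.out).subtype).map
          ((resCompIso (mackeySubgroup H κ q.out).subtype κ (ι q.out) (hι _)).hom.app _ ≫
            (coindEval k (ι q.out) (mackeyHom H κ q.out) q.out (h _)).app V) ≫
        (extendByZero k H κ q.out).app V = 𝟙 _ := by
  ext φ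
  let ψ (g : G) : (Rep.coindFunctor.{u} k (mackeySubgroup H κ g).subtype).obj
      (Rep.res (mackeyHom H κ g) V) :=
    ((Rep.coindFunctor.{u} k (mackeySubgroup H κ g).subtype).map
      ((resCompIso (mackeySubgroup H κ g).subtype κ (ι g) (hι _)).hom.app _ ≫
        (coindEval k (ι g) (mackeyHom H κ g) g (h _)).app V)).hom
      (((Rep.resCoindAdjunction.{u} k (mackeySubgroup H κ g).subtype).unit.app _).hom φ)
  rw [Rep.sum_hom]
  exact (Representation.IntertwiningMap.sum_apply _ _ _ _ φ).trans
    (sum_extendByZero φ ψ fun _ _ ↦ rfl)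

end Mackey

end PlainRep

/-! ### Idempotent completeness -/

section Copower

variable (C : Type*) [Category C] [HasColimitsOfShape (Discrete ℕ) C]

/-- The functor `V ↦ V^(ℕ)`. -/
def countableCopower : C ⥤ C :=
  Functor.const (Discrete ℕ) ⋙ colim

namespace countableCopower

variable {C} {V W : C}

/-- The inclusion of the `n`-th summand. -/
def ι (n : ℕ) (V : C) : V ⟶ (countableCopower C).obj V :=
  colimit.ι ((Functor.const (Discrete ℕ)).obj V) ⟨n⟩

/-- The morphism out of `V^(ℕ)` given by a sequence of morphisms. -/
def desc (f : ℕ → (V ⟶ W)) : (countableCopower C).obj V ⟶ W :=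
  colimit.desc ((Functor.const (Discrete ℕ)).obj V) ⟨W, Discrete.natTrans fun n ↦ f n.as⟩

theorem hom_ext {f g : (countableCopower C).obj V ⟶ W} (h : ∀ n, ι n V ≫ f = ι n V ≫ g) : f = g :=
  colimit.hom_ext fun n ↦ h n.as

theorem ι_desc (f : ℕ → (V ⟶ W)) (n : ℕ) : ι n V ≫ desc f = f n :=
  colimit.ι_desc _ _

theorem ι_map (f : V ⟶ W) (n : ℕ) : ι n V ≫ (countableCopower C).map f = f ≫ ι n W :=
  ι_colimMap _ _

/-- A family of natural morphisms, one on each summand, is natural on `V^(ℕ)`. -/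
def descNatTrans {F : C ⥤ C} (f : ℕ → (𝟭 C ⟶ F)) : countableCopower C ⟶ F where
  app V := desc fun n ↦ (f n).app V
  naturality V W g := hom_ext fun n ↦ by
    rw [reassoc_of% ι_map, ι_desc, reassoc_of% ι_desc]
    exact (f n).naturality g

variable (C) in
/-- The inclusion of the `n`-th summand, as a natural transformation. -/
def ιNatTrans (n : ℕ) : 𝟭 C ⟶ countableCopower C where
  app := ι n
  naturality _ _ f := (ι_map f n).symm

theorem natTrans_ext {F : C ⥤ C} {f g : countableCopower C ⟶ F}
    (h : ∀ n, ιNatTrans C n ≫ f = ιNatTrans C n ≫ g) : f = g := by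
  ext V
  exact hom_ext fun n ↦ congr_app (h n) V

theorem ιNatTrans_descNatTrans {F : C ⥤ C} (f : ℕ → (𝟭 C ⟶ F)) (n : ℕ) :
    ιNatTrans C n ≫ descNatTrans f = f n := by
  ext V
  exact ι_desc (fun n ↦ (f n).app V) n

section Preadditive

variable [Preadditive C]

instance : (countableCopower C).Additive where
  map_add := hom_ext fun n ↦ by
    simp only [Preadditive.comp_add, ι_map, Preadditive.add_comp]

variable (C)

/-- The shift `n ↦ n + 1` of the summands. -/
def shift : countableCopower C ⟶ countableCopower C :=
  descNatTrans fun n ↦ ιNatTrans C (n + 1)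

/-- The left inverse `0 ↦ 0`, `n + 1 ↦ n` of the shift. -/
def unshift : countableCopower C ⟶ countableCopower C :=
  descNatTrans fun n ↦ match n with
    | 0 => 0
    | n + 1 => ιNatTrans C n

/-- The projection onto the zeroth summand. -/
def projZero : countableCopower C ⟶ 𝟭 C :=
  descNatTrans fun n ↦ match n with
    | 0 => 𝟙 _
    | _ + 1 => 0

theorem shift_unshift : shift C ≫ unshift C = 𝟙 (countableCopower C) :=
  natTrans_ext fun n ↦ by
    rw [shift, unshift, reassoc_of% ιNatTrans_descNatTrans, ιNatTrans_descNatTrans,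
      Category.comp_id]

theorem unshift_shift :
    unshift C ≫ shift C = 𝟙 (countableCopower C) - projZero C ≫ ιNatTrans C 0 :=
  natTrans_ext fun n ↦ by
    rw [shift, unshift, projZero, Preadditive.comp_sub, reassoc_of% ιNatTrans_descNatTrans,
      reassoc_of% ιNatTrans_descNatTrans, Category.comp_id]
    cases n with
    | zero => rw [Limits.zero_comp, Category.id_comp, sub_self]
    | succ n => simp only [ιNatTrans_descNatTrans, Limits.zero_comp, sub_zero]

theorem ιNatTrans_zero_projZero : ιNatTrans C 0 ≫ projZero C = 𝟙 (𝟭 C) :=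
  ιNatTrans_descNatTrans _ 0

end Preadditive

instance : (countableCopower C).PreservesProjectiveObjects where
  projective_obj {P} _ := ⟨fun f e _ ↦
    ⟨desc fun n ↦ Projective.factorThru (ι n P ≫ f) e, hom_ext fun n ↦ by
      rw [reassoc_of% ι_desc, Projective.factorThru_comp]⟩⟩

instance : PreservesFiniteColimits (countableCopower C) :=
  inferInstanceAs (PreservesFiniteColimits (Functor.const (Discrete ℕ) ⋙ colim))

instance [HasExactColimitsOfShape (Discrete ℕ) C] :
    PreservesFiniteLimits (countableCopower C) :=
  inferInstanceAs (PreservesFiniteLimits (Functor.const (Discrete ℕ) ⋙ colim))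

end countableCopower
end Copower

instance (k : Type u) [CommRing k] (G : Type u) [Group G] :
    HasExactColimitsOfShape (Discrete ℕ) (Rep.{u} k G) :=
  .of_codomain_equivalence _ Rep.equivalenceModuleMonoidAlgebra.symm

/-- The functor `V ↦ V^(ℕ)` on representations. -/
abbrev RepFunctor.countableCopower (k : Type u) [CommRing k] (G : Type u) [Group G] :
    RepFunctor k G G where
  functor := _root_.countableCopower (Rep.{u} k G)

open countableCopower in
theorem RepSystem.isIdempotentComplete {k : Type u} [CommRing k] (T : RepSystem.{u, a, b} k)
    (G : Type u) [Group G] : IsIdempotentComplete (T.Cat G) := by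
  let N := RepFunctor.countableCopower k G
  let R := Rep.{u} k G
  let z : 𝟭 (T.Cat G) ⟶ T.map N :=
    (T.mapId G).hom ≫ T.map₂ (A := .id k G) (B := N) (ιNatTrans R 0)
  let p : T.map N ⟶ 𝟭 (T.Cat G) :=
    T.map₂ (A := N) (B := .id k G) (projZero R) ≫ (T.mapId G).inv
  have hpz : p ≫ z = T.map₂ (A := N) (B := N) (projZero R ≫ ιNatTrans R 0) := by
    rw [T.map₂_comp (B := .id k G)]
    simp [p, z]
  have hzp : z ≫ p = 𝟙 _ := by
    have h : T.map₂ (A := .id k G) (B := N) (ιNatTrans R 0) ≫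
        T.map₂ (A := N) (B := .id k G) (projZero R) = 𝟙 _ := by
      rw [← T.map₂_comp, ιNatTrans_zero_projZero, ← T.map₂_id]
    simp [z, p, reassoc_of% h]
  refine (T.weaklyIdempotentComplete G).isIdempotentComplete
    (σ := T.map₂ (A := N) (B := N) (shift R)) (δ := T.map₂ (A := N) (B := N) (unshift R)) ?_ ?_ hzp
  · rw [← T.map₂_comp, shift_unshift, ← T.map₂_id]
  · rw [hpz, ← T.map₂_comp, ← T.map₂_id, unshift_shift, eq_sub_iff_add_eq, ← T.map₂_add,
      sub_add_cancel]

/-! ### Restriction, coinduction and the transformations between them -/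

/-- Injective group homomorphisms, along which the systems of categories have restriction
functors. -/
@[ext]
structure Emb (K L : Type u) [Group K] [Group L] extends K →* L where
  injective : Function.Injective toMonoidHom

namespace Emb

variable {I J K L G : Type u} [Group I] [Group J] [Group K] [Group L] [Group G]

instance : FunLike (Emb K L) K L where
  coe φ := φ.toMonoidHom
  coe_injective _ _ h := Emb.ext h

instance : MonoidHomClass (Emb K L) K L where
  map_mul φ := map_mul φ.toMonoidHom
  map_one φ := map_one φ.toMonoidHom

theorem hom_ext {φ ψ : Emb K L} (h : ∀ x, φ x = ψ x) : φ = ψ :=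
  DFunLike.ext _ _ h

variable (K) in
/-- The identity. -/
protected abbrev refl : Emb K K :=
  ⟨.id K, fun _ _ h ↦ h⟩

/-- The composite of two embeddings. -/
protected def comp (φ : Emb K L) (ψ : Emb J K) : Emb J L :=
  ⟨φ.toMonoidHom.comp ψ.toMonoidHom, φ.injective.comp ψ.injective⟩

/-- The embedding `x ↦ l φ(x) l⁻¹`. -/
protected def conj (φ : Emb K L) (l : L) : Emb K L :=
  ⟨(MulAut.conj l).toMonoidHom.comp φ.toMonoidHom, (MulAut.conj l).injective.comp φ.injective⟩

/-- The inclusion of a subgroup. -/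
protected abbrev subtype (H : Subgroup G) : Emb H G :=
  ⟨H.subtype, H.subtype_injective⟩

/-- The corestriction to a subgroup that contains the image. -/
protected def codRestrict (φ : Emb K L) (S : Subgroup L) (h : ∀ x, φ x ∈ S) : Emb K S :=
  ⟨φ.toMonoidHom.codRestrict S h, fun _ _ hxy ↦ φ.injective (Subtype.ext_iff.1 hxy)⟩

theorem conj_apply (φ : Emb K L) (l : L) (x : K) : φ.conj l x = l * φ x * l⁻¹ := rfl

theorem comp_assoc (φ : Emb K L) (ψ : Emb J K) (θ : Emb I J) :
    (φ.comp ψ).comp θ = φ.comp (ψ.comp θ) := rfl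

theorem conj_comp (φ : Emb K L) (l : L) (ψ : Emb J K) : (φ.conj l).comp ψ = (φ.comp ψ).conj l :=
  rfl

theorem conj_one (φ : Emb K L) : φ.conj 1 = φ :=
  hom_ext fun x ↦ by simp [conj_apply]

theorem conj_conj (φ : Emb K L) (l l' : L) : (φ.conj l).conj l' = φ.conj (l' * l) :=
  hom_ext fun x ↦ by simp [conj_apply, mul_assoc]

theorem comp_conj (φ : Emb K L) (ψ : Emb J K) (x : K) :
    φ.comp (ψ.conj x) = (φ.comp ψ).conj (φ x) :=
  hom_ext fun y ↦ show φ (x * ψ y * x⁻¹) = φ x * φ (ψ y) * (φ x)⁻¹ by simp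

/-- The embedding of `J ∩ g⁻¹ H g` into `H`, where `J` is considered as a subgroup by means
of `κ`. -/
protected abbrev mackey (H : Subgroup G) (κ : Emb J G) (g : G) :
    Emb (PlainRep.mackeySubgroup H κ.toMonoidHom g) H :=
  ⟨PlainRep.mackeyHom H κ.toMonoidHom g, fun _ _ h ↦
    Subtype.ext (κ.injective ((MulAut.conj g).injective (congrArg Subtype.val h)))⟩

theorem conj_comp_subtype_mackey (H : Subgroup G) (κ : Emb J G) (g : G) :
    (κ.comp (.subtype (PlainRep.mackeySubgroup H κ.toMonoidHom g))).conj g =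
      (Emb.subtype H).comp (.mackey H κ g) :=
  rfl

end Emb

namespace RepSystem

variable {k : Type u} [CommRing k]

section Transformations

variable (T : RepSystem.{u, a, b} k) {J K L G : Type u} [Group J] [Group K] [Group L] [Group G]

/-- Restriction along an injective homomorphism. -/
abbrev res (φ : Emb K L) : T.Cat L ⥤ T.Cat K := T.map (.res k φ.toMonoidHom φ.injective)

/-- The identification of a composite of restrictions with a restriction. -/
def resCompIso {φ : Emb K L} {ψ : Emb J K} {χ : Emb J L} (h : φ.comp ψ = χ) :
    T.res φ ⋙ T.res ψ ≅ T.res χ :=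
  T.mapComp _ _ ≪≫ T.mapIso
    (A := (RepFunctor.res k φ.toMonoidHom φ.injective).comp (.res k ψ.toMonoidHom ψ.injective))
    (B := .res k χ.toMonoidHom χ.injective)
    (PlainRep.resCompIso ψ.toMonoidHom φ.toMonoidHom χ.toMonoidHom fun x ↦
      (DFunLike.congr_fun h x).symm)

/-- The action of `l`, as an isomorphism between restrictions along conjugate embeddings. -/
def twistIso {φ ψ : Emb K L} {l : L} (h : φ.conj l = ψ) : T.res φ ≅ T.res ψ :=
  T.mapIso (A := .res k φ.toMonoidHom φ.injective) (B := .res k ψ.toMonoidHom ψ.injective)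
    (PlainRep.twistIso φ.toMonoidHom ψ.toMonoidHom l fun x ↦ (DFunLike.congr_fun h x).symm)

variable (K) in
/-- The identification of the restriction along the identity with the identity. -/
def resIdIso : T.res (.refl K) ≅ 𝟭 (T.Cat K) :=
  T.mapIso (A := .res k (Emb.refl K).toMonoidHom (Emb.refl K).injective) (B := .id k K)
    (PlainRep.resIdIso k K) ≪≫ (T.mapId K).symm

variable (H : Subgroup G) [H.FiniteIndex]

/-- Coinduction from a subgroup of finite index. -/
abbrev coind : T.Cat H ⥤ T.Cat G := T.map (.coind k H)

/-- Evaluation of coinduced objects at `g`. -/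
def evalTrans {κ : Emb J G} {β : Emb J H} {g : G} (h : κ.conj g = (Emb.subtype H).comp β) :
    T.coind H ⋙ T.res κ ⟶ T.res β :=
  (T.mapComp _ _).hom ≫ T.map₂
    (A := (RepFunctor.coind k H).comp (.res k κ.toMonoidHom κ.injective))
    (B := .res k β.toMonoidHom β.injective)
    (PlainRep.coindEval k κ.toMonoidHom β.toMonoidHom g fun x ↦ (DFunLike.congr_fun h x).symm)

/-- The unit of the adjunction between restriction and coinduction. -/
def coindUnitTrans : 𝟭 (T.Cat G) ⟶ T.res (.subtype H) ⋙ T.coind H :=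
  (T.mapId G).hom ≫ T.map₂ (A := .id k G)
    (B := (RepFunctor.res k (Emb.subtype H).toMonoidHom (Emb.subtype H).injective).comp
      (.coind k H))
    (Rep.resCoindAdjunction.{u} k H.subtype).unit ≫ (T.mapComp _ _).inv

/-- The counit of the adjunction between restriction and coinduction. -/
def coindCounitTrans : T.coind H ⋙ T.res (.subtype H) ⟶ 𝟭 (T.Cat H) :=
  (T.mapComp _ _).hom ≫ T.map₂ (B := .id k H)
    (A := (RepFunctor.coind k H).comp (.res k H.subtype H.subtype_injective))
    (Rep.resCoindAdjunction.{u} k H.subtype).counit ≫ (T.mapId H).inv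

/-- The retraction of the unit given by averaging, if `c` is inverse to the index. -/
def averageTrans (c : k) : T.res (.subtype H) ⋙ T.coind H ⟶ 𝟭 (T.Cat G) :=
  (T.mapComp _ _).hom ≫ T.map₂ (B := .id k G)
    (A := (RepFunctor.res k (Emb.subtype H).toMonoidHom (Emb.subtype H).injective).comp
      (.coind k H))
    (PlainRep.average (H := H) c) ≫ (T.mapId G).inv

/-- Extension by zero from the double coset of `g`. -/
def extendByZeroTrans (κ : Emb J G) (g : G) :
    T.res (.mackey H κ g) ⋙ T.coind (PlainRep.mackeySubgroup H κ.toMonoidHom g) ⟶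
      T.coind H ⋙ T.res κ :=
  (T.mapComp _ _).hom ≫ T.map₂
    (A := (RepFunctor.res k (Emb.mackey H κ g).toMonoidHom (Emb.mackey H κ g).injective).comp
      (.coind k (PlainRep.mackeySubgroup H κ.toMonoidHom g)))
    (B := (RepFunctor.coind k H).comp (.res k κ.toMonoidHom κ.injective))
    (PlainRep.extendByZero k H κ.toMonoidHom g) ≫ (T.mapComp _ _).inv

end Transformations

/-! ### Components of the transformations -/

section Components

variable {T : RepSystem.{u, a, b} k} {J K L M G : Type u}
variable [Group J] [Group K] [Group L] [Group M] [Group G]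

/-- The component of `resCompIso`. -/
def resComp {φ : Emb K L} {ψ : Emb J K} {χ : Emb J L} (h : φ.comp ψ = χ) (Y : T.Cat L) :
    (T.res ψ).obj ((T.res φ).obj Y) ≅ (T.res χ).obj Y :=
  (T.resCompIso h).app Y

theorem resComp_naturality {φ : Emb K L} {ψ : Emb J K} {χ : Emb J L} (h : φ.comp ψ = χ)
    {Y Y' : T.Cat L} (f : Y ⟶ Y') :
    (T.res ψ).map ((T.res φ).map f) ≫ (resComp h Y').hom = (resComp h Y).hom ≫ (T.res χ).map f :=
  (T.resCompIso h).hom.naturality f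

/-- The component of `twistIso`. -/
def twist {φ ψ : Emb K L} {l : L} (h : φ.conj l = ψ) (Y : T.Cat L) :
    (T.res φ).obj Y ≅ (T.res ψ).obj Y :=
  (T.twistIso h).app Y

theorem twist_naturality {φ ψ : Emb K L} {l : L} (h : φ.conj l = ψ) {Y Y' : T.Cat L}
    (f : Y ⟶ Y') :
    (T.res φ).map f ≫ (twist h Y').hom = (twist h Y).hom ≫ (T.res ψ).map f :=
  (T.twistIso h).hom.naturality f

/-- The component of `resIdIso`. -/
def resId (Y : T.Cat K) : (T.res (.refl K)).obj Y ≅ Y :=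
  (T.resIdIso K).app Y

theorem resId_naturality {Y Y' : T.Cat K} (f : Y ⟶ Y') :
    (T.res (.refl K)).map f ≫ (resId Y').hom = (resId Y).hom ≫ f :=
  (T.resIdIso K).hom.naturality f

variable {H : Subgroup G} [H.FiniteIndex]

/-- The component of `evalTrans`. -/
def eval {κ : Emb J G} {β : Emb J H} {g : G} (h : κ.conj g = (Emb.subtype H).comp β)
    (X : T.Cat H) : (T.res κ).obj ((T.coind H).obj X) ⟶ (T.res β).obj X :=
  (T.evalTrans H h).app X

theorem eval_naturality {κ : Emb J G} {β : Emb J H} {g : G}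
    (h : κ.conj g = (Emb.subtype H).comp β) {X X' : T.Cat H} (f : X ⟶ X') :
    (T.res κ).map ((T.coind H).map f) ≫ eval h X' = eval h X ≫ (T.res β).map f :=
  (T.evalTrans H h).naturality f

variable (H) in
/-- The component of `coindUnitTrans`. -/
def coindUnit (Y : T.Cat G) : Y ⟶ (T.coind H).obj ((T.res (.subtype H)).obj Y) :=
  (T.coindUnitTrans H).app Y

variable (H) in
theorem coindUnit_naturality {Y Y' : T.Cat G} (f : Y ⟶ Y') :
    f ≫ coindUnit H Y' = coindUnit H Y ≫ (T.coind H).map ((T.res (.subtype H)).map f) :=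
  (T.coindUnitTrans H).naturality f

/-- The component of `coindCounitTrans`. -/
def coindCounit (X : T.Cat H) : (T.res (.subtype H)).obj ((T.coind H).obj X) ⟶ X :=
  (T.coindCounitTrans H).app X

theorem coindCounit_naturality {X X' : T.Cat H} (f : X ⟶ X') :
    (T.res (.subtype H)).map ((T.coind H).map f) ≫ coindCounit X' = coindCounit X ≫ f :=
  (T.coindCounitTrans H).naturality f

variable (H) in
/-- The component of `averageTrans`. -/
def average (c : k) (Y : T.Cat G) : (T.coind H).obj ((T.res (.subtype H)).obj Y) ⟶ Y :=
  (T.averageTrans H c).app Y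

variable (H) in
theorem average_naturality (c : k) {Y Y' : T.Cat G} (f : Y ⟶ Y') :
    (T.coind H).map ((T.res (.subtype H)).map f) ≫ average H c Y' = average H c Y ≫ f :=
  (T.averageTrans H c).naturality f

/-- The component of `extendByZeroTrans`. -/
def extendByZero (κ : Emb J G) (g : G) (X : T.Cat H) :
    (T.coind (PlainRep.mackeySubgroup H κ.toMonoidHom g)).obj
      ((T.res (.mackey H κ g)).obj X) ⟶ (T.res κ).obj ((T.coind H).obj X) :=
  (T.extendByZeroTrans H κ g).app X

section Induced

variable (V : T.Cat M)

theorem resComp_eq_induced {φ : Emb K L} {ψ : Emb J K} {χ : Emb J L} (h : φ.comp ψ = χ)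
    (Y : T.Cat L) [Presentation V Y] :
    (resComp h Y).hom = induced V ((Functor.associator _ _ _).hom ≫
      Functor.whiskerLeft (Presentation.functor V Y).functor
        (PlainRep.resCompIso ψ.toMonoidHom φ.toMonoidHom χ.toMonoidHom fun x ↦
          (DFunLike.congr_fun h x).symm).hom) := by
  simp only [resComp, Iso.app_hom, resCompIso, Iso.trans_hom, NatTrans.comp_app, Functor.comp_obj,
    mapIso_hom]
  rw [mapComp_hom_app_eq_induced V, map₂_app_eq_induced V]
  simp only [induced_comp]

theorem twist_eq_induced {φ ψ : Emb K L} {l : L} (h : φ.conj l = ψ) (Y : T.Cat L)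
    [Presentation V Y] :
    (twist h Y).hom = induced V (Functor.whiskerLeft (Presentation.functor V Y).functor
      (PlainRep.twistIso φ.toMonoidHom ψ.toMonoidHom l fun x ↦
        (DFunLike.congr_fun h x).symm).hom) := by
  simp only [twist, Iso.app_hom, twistIso, mapIso_hom]
  rw [map₂_app_eq_induced V]

theorem resId_eq_induced (Y : T.Cat K) [Presentation V Y] :
    (resId Y).hom = induced V (Y := (T.res (.refl K)).obj Y) (Y' := Y)
      (Functor.whiskerLeft (Presentation.functor V Y).functor (PlainRep.resIdIso k K).hom ≫
        (Functor.rightUnitor _).hom) := by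
  simp only [resId, Iso.app_hom, resIdIso, Iso.trans_hom, NatTrans.comp_app, Functor.id_obj,
    mapIso_hom, Iso.symm_hom]
  rw [mapId_inv_app_eq_induced V, map₂_app_eq_induced V]
  simp only [induced_comp]

theorem eval_eq_induced {κ : Emb J G} {β : Emb J H} {g : G}
    (h : κ.conj g = (Emb.subtype H).comp β) (X : T.Cat H) [Presentation V X] :
    eval h X = induced V ((Functor.associator _ _ _).hom ≫
      Functor.whiskerLeft (Presentation.functor V X).functor
        (PlainRep.coindEval k κ.toMonoidHom β.toMonoidHom g fun x ↦
          (DFunLike.congr_fun h x).symm)) := by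
  simp only [eval, evalTrans, NatTrans.comp_app, Functor.comp_obj]
  rw [mapComp_hom_app_eq_induced V, map₂_app_eq_induced V]
  simp only [induced_comp]

theorem coindUnit_eq_induced (Y : T.Cat G) [Presentation V Y] :
    coindUnit H Y = induced V ((Functor.rightUnitor _).inv ≫
      Functor.whiskerLeft (Presentation.functor V Y).functor
        (Rep.resCoindAdjunction.{u} k H.subtype).unit ≫ (Functor.associator _ _ _).inv) := by
  simp only [coindUnit, coindUnitTrans, NatTrans.comp_app, Functor.comp_obj, Functor.id_obj]
  rw [mapComp_inv_app_eq_induced V, map₂_app_eq_induced V, mapId_hom_app_eq_induced V]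
  simp only [induced_comp]

theorem coindCounit_eq_induced (X : T.Cat H) [Presentation V X] :
    coindCounit X = induced V ((Functor.associator _ _ _).hom ≫
      Functor.whiskerLeft (Presentation.functor V X).functor
        (Rep.resCoindAdjunction.{u} k H.subtype).counit ≫ (Functor.rightUnitor _).hom) := by
  simp only [coindCounit, coindCounitTrans, NatTrans.comp_app, Functor.comp_obj, Functor.id_obj]
  rw [mapComp_hom_app_eq_induced V, map₂_app_eq_induced V, mapId_inv_app_eq_induced V]
  simp only [induced_comp]

theorem average_eq_induced (c : k) (Y : T.Cat G) [Presentation V Y] :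
    average H c Y = induced V ((Functor.associator _ _ _).hom ≫
      Functor.whiskerLeft (Presentation.functor V Y).functor (PlainRep.average (H := H) c) ≫
        (Functor.rightUnitor _).hom) := by
  simp only [average, averageTrans, NatTrans.comp_app, Functor.comp_obj, Functor.id_obj]
  rw [mapComp_hom_app_eq_induced V, map₂_app_eq_induced V, mapId_inv_app_eq_induced V]
  simp only [induced_comp]

theorem extendByZero_eq_induced (κ : Emb J G) (g : G) (X : T.Cat H) [Presentation V X] :
    extendByZero κ g X = induced V ((Functor.associator _ _ _).hom ≫
      Functor.whiskerLeft (Presentation.functor V X).functor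
        (PlainRep.extendByZero k H κ.toMonoidHom g) ≫ (Functor.associator _ _ _).inv) := by
  simp only [extendByZero, extendByZeroTrans, NatTrans.comp_app, Functor.comp_obj]
  rw [mapComp_inv_app_eq_induced V, map₂_app_eq_induced V, mapComp_hom_app_eq_induced V]
  simp only [induced_comp]

end Induced
end Components
end RepSystem

namespace RepSystem

variable {k : Type u} [CommRing k] {T : RepSystem.{u, a, b} k}
variable {I J K L G : Type u} [Group I] [Group J] [Group K] [Group L] [Group G]

theorem resComp_assoc {θ : Emb I J} {ψ : Emb J K} {φ : Emb K L} {ψθ : Emb I K} {φψ : Emb J L}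
    {χ : Emb I L} (h₁ : ψ.comp θ = ψθ) (h₂ : φ.comp ψ = φψ) (h₃ : φψ.comp θ = χ)
    (h₄ : φ.comp ψθ = χ) (Y : T.Cat L) :
    (T.res θ).map (resComp h₂ Y).hom ≫ (resComp h₃ Y).hom =
      (resComp h₁ ((T.res φ).obj Y)).hom ≫ (resComp h₄ Y).hom := by
  simp only [resComp_eq_induced Y, map_induced, induced_comp]
  congr 1

theorem resComp_eq_resId {φ : Emb K L} (h : φ.comp (.refl K) = φ) (Y : T.Cat L) :
    (resComp h Y).hom = (resId ((T.res φ).obj Y)).hom := by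
  simp only [resComp_eq_induced Y, resId_eq_induced Y]
  congr 1

theorem twist_one {φ : Emb K L} (h : φ.conj 1 = φ) (Y : T.Cat L) : (twist h Y).hom = 𝟙 _ := by
  rw [id_eq_induced Y, twist_eq_induced Y]
  congr 1
  ext V x
  exact congrArg (fun f ↦ f x) (map_one (Rep.ρ V))

theorem map_twist {ψ : Emb J K} {φ φ' : Emb K L} {χ χ' : Emb J L} {l : L} (h : φ.comp ψ = χ)
    (h' : φ'.comp ψ = χ') (hl : φ.conj l = φ') (hl' : χ.conj l = χ') (Y : T.Cat L) :
    (T.res ψ).map (twist hl Y).hom ≫ (resComp h' Y).hom =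
      (resComp h Y).hom ≫ (twist hl' Y).hom := by
  simp only [resComp_eq_induced Y, twist_eq_induced Y, map_induced, induced_comp]
  congr 1

theorem twist_resComp {ψ ψ' : Emb J K} {φ : Emb K L} {χ χ' : Emb J L} {x : K}
    (h : φ.comp ψ = χ) (h' : φ.comp ψ' = χ') (hx : ψ.conj x = ψ') (hx' : χ.conj (φ x) = χ')
    (Y : T.Cat L) :
    (twist hx ((T.res φ).obj Y)).hom ≫ (resComp h' Y).hom =
      (resComp h Y).hom ≫ (twist hx' Y).hom := by
  simp only [resComp_eq_induced Y, twist_eq_induced Y, induced_comp]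
  congr 1

variable {H : Subgroup G} [H.FiniteIndex]

theorem coindUnit_coindCounit (Y : T.Cat G) :
    (T.res (.subtype H)).map (coindUnit H Y) ≫ coindCounit _ = 𝟙 _ := by
  rw [id_eq_induced Y]
  simp only [coindCounit_eq_induced Y, coindUnit_eq_induced Y, map_induced, induced_comp]
  congr 1
  ext V x
  exact congrArg (fun f ↦ f.hom x)
    ((Rep.resCoindAdjunction.{u} k H.subtype).left_triangle_components V)

theorem coindUnit_map_coindCounit (X : T.Cat H) :
    coindUnit H _ ≫ (T.coind H).map (coindCounit X) = 𝟙 _ := by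
  rw [id_eq_induced X]
  simp only [coindCounit_eq_induced X, coindUnit_eq_induced X, map_induced, induced_comp]
  congr 1
  ext V x
  exact congrArg (fun f ↦ f.hom x)
    ((Rep.resCoindAdjunction.{u} k H.subtype).right_triangle_components V)

theorem coindUnit_average {c : k} (hc : c * H.index = 1) (Y : T.Cat G) :
    coindUnit H Y ≫ average H c Y = 𝟙 _ := by
  rw [id_eq_induced Y]
  simp only [average_eq_induced Y, coindUnit_eq_induced Y, induced_comp]
  congr 1
  ext V x
  exact congrArg (fun f ↦ f.hom x) (congr_app (PlainRep.unit_average H c hc) V)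

theorem coindUnit_eval {κ χ : Emb J G} {β : Emb J H} {g : G}
    (h : κ.conj g = (Emb.subtype H).comp β) (h₁ : (Emb.subtype H).comp β = χ)
    (h₂ : κ.conj g = χ) (Y : T.Cat G) :
    (T.res κ).map (coindUnit H Y) ≫ eval h _ ≫ (resComp h₁ Y).hom = (twist h₂ Y).hom := by
  simp only [resComp_eq_induced Y, twist_eq_induced Y, eval_eq_induced Y, coindUnit_eq_induced Y,
    map_induced, induced_comp]
  congr 1

theorem eval_one (h₁ : (Emb.subtype H).comp (.refl H) = .subtype H)
    (h₂ : (Emb.subtype H).conj 1 = (Emb.subtype H).comp (.refl H)) (X : T.Cat H) :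
    (resComp h₁ _).hom ≫ eval h₂ X ≫ (resId X).hom = (resId _).hom ≫ coindCounit X := by
  simp only [resComp_eq_induced X, eval_eq_induced X, resId_eq_induced X,
    coindCounit_eq_induced X, induced_comp]
  congr 1

theorem map_eval {θ : Emb I J} {κ : Emb J G} {β : Emb J H} {κ' : Emb I G} {β' : Emb I H} {g : G}
    (h : κ.conj g = (Emb.subtype H).comp β) (h' : κ'.conj g = (Emb.subtype H).comp β')
    (hκ : κ.comp θ = κ') (hβ : β.comp θ = β') (X : T.Cat H) :
    (T.res θ).map (eval h X) ≫ (resComp hβ X).hom = (resComp hκ _).hom ≫ eval h' X := by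
  simp only [resComp_eq_induced X, eval_eq_induced X, map_induced, induced_comp]
  congr 1

theorem twist_eval {κ κ' : Emb J G} {β : Emb J H} {g₁ g₂ : G} (h₁ : κ.conj g₁ = κ')
    (h₂ : κ'.conj g₂ = (Emb.subtype H).comp β)
    (h : κ.conj (g₂ * g₁) = (Emb.subtype H).comp β) (X : T.Cat H) :
    (twist h₁ _).hom ≫ eval h₂ X = eval h X := by
  simp only [twist_eq_induced X, eval_eq_induced X, induced_comp]
  congr 1

theorem eval_twist {κ : Emb J G} {β β' : Emb J H} {g : G} {x : H}
    (h₁ : κ.conj g = (Emb.subtype H).comp β) (h₂ : β.conj x = β')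
    (h : κ.conj (x * g) = (Emb.subtype H).comp β') (X : T.Cat H) :
    eval h₁ X ≫ (twist h₂ X).hom = eval h X := by
  simp only [twist_eq_induced X, eval_eq_induced X, induced_comp]
  congr 1
  ext V φ
  exact (PlainRep.coindApply_mul x g φ).symm

section ExtendByZero

variable (κ : Emb J G) {g : G}

theorem extendByZero_eval (X : T.Cat H) :
    (T.res (.subtype (PlainRep.mackeySubgroup H κ.toMonoidHom g))).map (extendByZero κ g X) ≫
        (resComp (Eq.refl (κ.comp (.subtype _))) _).hom ≫
          eval (Emb.conj_comp_subtype_mackey H κ g) X =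
      coindCounit _ := by
  simp only [resComp_eq_induced X, eval_eq_induced X, extendByZero_eq_induced X,
    coindCounit_eq_induced X, map_induced, induced_comp]
  congr 1
  ext V : 2
  exact PlainRep.extendByZero_comp_coindEval H κ.toMonoidHom g _ (fun _ ↦ rfl) (fun _ ↦ rfl) _

theorem extendByZero_eval_of_ne {g' : G} (hg : ∀ (h : H) (x : J), h * g * κ x ≠ g') (X : T.Cat H) :
    (T.res (.subtype (PlainRep.mackeySubgroup H κ.toMonoidHom g'))).map (extendByZero κ g X) ≫
        (resComp (Eq.refl (κ.comp (.subtype _))) _).hom ≫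
          eval (Emb.conj_comp_subtype_mackey H κ g') X =
      0 := by
  rw [zero_eq_induced X]
  simp only [resComp_eq_induced X, eval_eq_induced X, extendByZero_eq_induced X, map_induced,
    induced_comp]
  congr 1
  ext V : 2
  exact PlainRep.extendByZero_comp_coindEval_of_ne κ.toMonoidHom hg _ (fun _ ↦ rfl)
    (fun _ ↦ rfl) _

theorem sum_coindUnit_eval_extendByZero
    [Fintype (DoubleCoset.Quotient (H : Set G) (κ.toMonoidHom.range : Set G))] (X : T.Cat H) :
    ∑ q : DoubleCoset.Quotient (H : Set G) (κ.toMonoidHom.range : Set G),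
      coindUnit (PlainRep.mackeySubgroup H κ.toMonoidHom q.out)
          ((T.res κ).obj ((T.coind H).obj X)) ≫
        (T.coind _).map ((resComp (Eq.refl (κ.comp (.subtype _))) _).hom ≫
          eval (Emb.conj_comp_subtype_mackey H κ q.out) X) ≫
        extendByZero κ q.out X = 𝟙 _ := by
  rw [id_eq_induced X]
  simp only [resComp_eq_induced X, eval_eq_induced X, extendByZero_eq_induced X,
    coindUnit_eq_induced X, map_induced, induced_comp, sum_induced]
  congr 1
  ext V : 2
  rw [NatTrans.app_sum]
  exact PlainRep.sum_unit_comp_extendByZero H κ.toMonoidHom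
    (fun g ↦ (κ.comp (.subtype (PlainRep.mackeySubgroup H κ.toMonoidHom g))).toMonoidHom)
    (fun _ _ ↦ rfl) (fun _ _ ↦ rfl) V

end ExtendByZero

end RepSystem

/-! ### Morphisms into coinduced objects -/

theorem finite_doubleCosetQuotient {G : Type*} [Group G] (H K : Subgroup G) [H.FiniteIndex] :
    Finite (DoubleCoset.Quotient (H : Set G) (K : Set G)) := by
  have : Finite (Quotient (QuotientGroup.rightRel H)) :=
    Finite.of_equiv _ (QuotientGroup.quotientRightRelEquivQuotientLeftRel H).symm
  refine Finite.of_surjective (Quotient.map' (s₁ := QuotientGroup.rightRel H) id fun x y h ↦ ?_)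
    (Quotient.mk_surjective.forall.2 fun x ↦ ⟨Quotient.mk _ x, rfl⟩)
  exact DoubleCoset.rel_iff.2 ⟨y * x⁻¹, QuotientGroup.rightRel_apply.1 h, 1, K.one_mem, by simp⟩

namespace RepSystem

variable {k : Type u} [CommRing k] {T : RepSystem.{u, a, b} k}
variable {I J K G : Type u} [Group I] [Group J] [Group K] [Group G]
variable {H : Subgroup G} [H.FiniteIndex]

/-- The component at `g` of a morphism into a restricted coinduced object: its composite with the
evaluation at `g`, which is linear over any group `I` that acts compatibly on both sides. -/
def component {κ : Emb J G} {θ : Emb I J} {β : Emb I H} {g : G}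
    (h : (κ.comp θ).conj g = (Emb.subtype H).comp β) {Z : T.Cat J} {X : T.Cat H}
    (m : Z ⟶ (T.res κ).obj ((T.coind H).obj X)) : (T.res θ).obj Z ⟶ (T.res β).obj X :=
  (T.res θ).map m ≫ (resComp (Eq.refl (κ.comp θ)) _).hom ≫ eval h X

section Component

variable {κ : Emb J G} {θ : Emb I J} {β : Emb I H} {g : G}
  (h : (κ.comp θ).conj g = (Emb.subtype H).comp β) {Z : T.Cat J} {X : T.Cat H}

theorem comp_component {Z' : T.Cat J} (f : Z' ⟶ Z) (m : Z ⟶ (T.res κ).obj ((T.coind H).obj X)) :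
    component h (f ≫ m) = (T.res θ).map f ≫ component h m := by
  simp only [component, Functor.map_comp, Category.assoc]

theorem component_comp {X' : T.Cat H} (m : Z ⟶ (T.res κ).obj ((T.coind H).obj X)) (f : X ⟶ X') :
    component h (m ≫ (T.res κ).map ((T.coind H).map f)) = component h m ≫ (T.res β).map f := by
  simp only [component, Functor.map_comp, Category.assoc, ← eval_naturality]
  rw [reassoc_of% resComp_naturality (Eq.refl (κ.comp θ))]

theorem component_comp_coindUnit {Y : T.Cat G} {χ : Emb I G}
    (h₁ : (Emb.subtype H).comp β = χ) (h₂ : (κ.comp θ).conj g = χ) (m : Z ⟶ (T.res κ).obj Y) :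
    component h (m ≫ (T.res κ).map (coindUnit H Y)) ≫ (resComp h₁ Y).hom =
      (T.res θ).map m ≫ (resComp (Eq.refl (κ.comp θ)) Y).hom ≫ (twist h₂ Y).hom := by
  simp only [component, Functor.map_comp, Category.assoc]
  rw [reassoc_of% resComp_naturality (Eq.refl (κ.comp θ)), coindUnit_eval h h₁ h₂]

theorem map_component {ι : Emb K I} {θ' : Emb K J} {β' : Emb K H} (hθ : θ.comp ι = θ')
    (hβ : β.comp ι = β') (h' : (κ.comp θ').conj g = (Emb.subtype H).comp β')
    (m : Z ⟶ (T.res κ).obj ((T.coind H).obj X)) :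
    (T.res ι).map (component h m) ≫ (resComp hβ X).hom =
      (resComp hθ Z).hom ≫ component h' m := by
  have hχ : (κ.comp θ).comp ι = κ.comp θ' := hθ ▸ rfl
  simp only [component, Functor.map_comp, Category.assoc]
  rw [map_eval h h' hχ hβ, reassoc_of% resComp_assoc hθ (Eq.refl (κ.comp θ)) hχ (Eq.refl _),
    reassoc_of% resComp_naturality hθ m]

theorem twist_component_twist {θ' : Emb I J} {β' : Emb I H} {x : J} {y : H}
    (hx : θ.conj x = θ') (hy : β.conj y = β')
    (h' : (κ.comp θ').conj g = (Emb.subtype H).comp β)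
    (h'' : (κ.comp θ).conj (y * (g * κ x)) = (Emb.subtype H).comp β')
    (m : Z ⟶ (T.res κ).obj ((T.coind H).obj X)) :
    (twist hx Z).hom ≫ component h' m ≫ (twist hy X).hom = component h'' m := by
  have hκ : (κ.comp θ).conj (κ x) = κ.comp θ' := by rw [← Emb.comp_conj, hx]
  have hg : (κ.comp θ).conj (g * κ x) = (Emb.subtype H).comp β := by
    rw [← Emb.conj_conj, hκ, h']
  simp only [component, Category.assoc]
  rw [← reassoc_of% twist_naturality hx m,
    reassoc_of% twist_resComp (Eq.refl (κ.comp θ)) (Eq.refl (κ.comp θ')) hx hκ,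
    reassoc_of% twist_eval hκ h' hg, eval_twist hg hy h'']

end Component

section Mackey

variable {κ : Emb J G} {Z : T.Cat J} {X : T.Cat H}

theorem component_ext {m m' : Z ⟶ (T.res κ).obj ((T.coind H).obj X)}
    (h : ∀ g, component (Emb.conj_comp_subtype_mackey H κ g) m =
      component (Emb.conj_comp_subtype_mackey H κ g) m') : m = m' := by
  have := finite_doubleCosetQuotient H κ.toMonoidHom.range
  have := Fintype.ofFinite (DoubleCoset.Quotient (H : Set G) (κ.toMonoidHom.range : Set G))
  rw [← Category.comp_id m, ← Category.comp_id m', ← sum_coindUnit_eval_extendByZero κ X,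
    Preadditive.comp_sum, Preadditive.comp_sum]
  refine Finset.sum_congr rfl fun q _ ↦ ?_
  rw [reassoc_of% coindUnit_naturality _ m, reassoc_of% coindUnit_naturality _ m',
    ← Functor.map_comp_assoc, ← Functor.map_comp_assoc]
  exact congrArg (fun f ↦ coindUnit _ Z ≫ (T.coind _).map f ≫ extendByZero κ q.out X) (h q.out)

theorem exists_component_eq (μ : (g : G) →
      ((T.res (.subtype (PlainRep.mackeySubgroup H κ.toMonoidHom g))).obj Z ⟶
        (T.res (.mackey H κ g)).obj X)) :
    ∃ m : Z ⟶ (T.res κ).obj ((T.coind H).obj X),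
      ∀ q : DoubleCoset.Quotient (H : Set G) (κ.toMonoidHom.range : Set G),
        component (Emb.conj_comp_subtype_mackey H κ q.out) m = μ q.out := by
  have := finite_doubleCosetQuotient H κ.toMonoidHom.range
  have := Fintype.ofFinite (DoubleCoset.Quotient (H : Set G) (κ.toMonoidHom.range : Set G))
  refine ⟨∑ q : DoubleCoset.Quotient (H : Set G) (κ.toMonoidHom.range : Set G),
    coindUnit _ Z ≫ (T.coind _).map (μ q.out) ≫ extendByZero κ q.out X, fun q ↦ ?_⟩
  rw [component, Functor.map_sum, Preadditive.sum_comp, Finset.sum_eq_single q]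
  · simp only [Functor.map_comp, Category.assoc]
    rw [extendByZero_eval, coindCounit_naturality, reassoc_of% coindUnit_coindCounit]
  · intro q' _ hq
    have hne (h : H) (x : J) : h * q'.out * κ x ≠ q.out := fun e ↦ hq <| by
      rw [← DoubleCoset.out_eq' H κ.toMonoidHom.range q,
        ← DoubleCoset.out_eq' H κ.toMonoidHom.range q', DoubleCoset.eq]
      exact ⟨h, h.2, κ x, ⟨x, rfl⟩, e.symm⟩
    simp only [Functor.map_comp, Category.assoc]
    rw [extendByZero_eval_of_ne κ hne, comp_zero, comp_zero]
  · exact fun h ↦ absurd (Finset.mem_univ _) h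

end Mackey

end RepSystem

/-! ### Restriction of morphisms between restrictions -/

namespace RepSystem

variable {k : Type u} [CommRing k] {T : RepSystem.{u, a, b} k}
variable {I J K L G : Type u} [Group I] [Group J] [Group K] [Group L] [Group G]

section ResHom

variable {j : Emb J K} {φ ψ : Emb K L} {φ' ψ' : Emb J L} (hφ : φ.comp j = φ') (hψ : ψ.comp j = ψ')
  {W W' W'' : T.Cat L}

/-- The restriction along `j` of a morphism between restrictions, as a morphism between the
restrictions along the composites with `j`. -/
def resHom (s : (T.res φ).obj W ⟶ (T.res ψ).obj W') : (T.res φ').obj W ⟶ (T.res ψ').obj W' :=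
  (resComp hφ W).inv ≫ (T.res j).map s ≫ (resComp hψ W').hom

theorem map_comp_resComp (s : (T.res φ).obj W ⟶ (T.res ψ).obj W') :
    (T.res j).map s ≫ (resComp hψ W').hom = (resComp hφ W).hom ≫ resHom hφ hψ s := by
  rw [resHom, Iso.hom_inv_id_assoc]

theorem resHom_comp {χ : Emb K L} {χ' : Emb J L} (hχ : χ.comp j = χ')
    (s : (T.res φ).obj W ⟶ (T.res ψ).obj W') (t : (T.res ψ).obj W' ⟶ (T.res χ).obj W'') :
    resHom hφ hχ (s ≫ t) = resHom hφ hψ s ≫ resHom hψ hχ t := by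
  simp only [resHom, Functor.map_comp, Category.assoc, Iso.hom_inv_id_assoc]

theorem resHom_map (f : W ⟶ W') : resHom hφ hφ ((T.res φ).map f) = (T.res φ').map f := by
  rw [resHom, resComp_naturality, Iso.inv_hom_id_assoc]

theorem resHom_twist {l : L} (h : φ.conj l = ψ) (h' : φ'.conj l = ψ') :
    resHom hφ hψ (twist h W).hom = (twist h' W).hom := by
  rw [resHom, map_twist hφ hψ h h', Iso.inv_hom_id_assoc]

theorem resHom_resHom {i : Emb I J} {ji : Emb I K} {φ'' ψ'' : Emb I L} (hji : j.comp i = ji)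
    (hφ' : φ'.comp i = φ'') (hψ' : ψ'.comp i = ψ'') (hφ'' : φ.comp ji = φ'')
    (hψ'' : ψ.comp ji = ψ'') (s : (T.res φ).obj W ⟶ (T.res ψ).obj W') :
    resHom hφ' hψ' (resHom hφ hψ s) = resHom hφ'' hψ'' s := by
  rw [← cancel_epi (resComp hφ' W).hom, ← cancel_epi ((T.res i).map (resComp hφ W).hom),
    ← map_comp_resComp, ← Functor.map_comp_assoc, ← map_comp_resComp,
    reassoc_of% resComp_assoc hji hφ hφ' hφ'', ← map_comp_resComp, Functor.map_comp_assoc,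
    resComp_assoc hji hψ hψ' hψ'', reassoc_of% resComp_naturality hji s]

theorem resHom_refl (hφ : φ.comp (.refl K) = φ) (hψ : ψ.comp (.refl K) = ψ)
    (s : (T.res φ).obj W ⟶ (T.res ψ).obj W') : resHom hφ hψ s = s := by
  rw [← cancel_epi (resComp hφ W).hom, ← map_comp_resComp, resComp_eq_resId hφ,
    resComp_eq_resId hψ, resId_naturality]

end ResHom

section Act

variable {H : Subgroup G}

/-- The action of `g` between two restrictions of an object restricted to `H`. -/
def act {α β : Emb J H} {g : G} (h : ((Emb.subtype H).comp α).conj g = (Emb.subtype H).comp β)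
    (V : T.Cat G) :
    (T.res α).obj ((T.res (.subtype H)).obj V) ⟶ (T.res β).obj ((T.res (.subtype H)).obj V) :=
  (resComp (Eq.refl ((Emb.subtype H).comp α)) V).hom ≫ (twist h V).hom ≫
    (resComp (Eq.refl ((Emb.subtype H).comp β)) V).inv

variable {α β : Emb J H} {g : G} (h : ((Emb.subtype H).comp α).conj g = (Emb.subtype H).comp β)

theorem act_eq {χ χ' : Emb J G} (hα : (Emb.subtype H).comp α = χ)
    (hβ : (Emb.subtype H).comp β = χ') (hχ : χ.conj g = χ') (V : T.Cat G) :
    act h V = (resComp hα V).hom ≫ (twist hχ V).hom ≫ (resComp hβ V).inv := by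
  subst hα hβ
  rfl

theorem act_naturality {V V' : T.Cat G} (f : V ⟶ V') :
    (T.res α).map ((T.res (.subtype H)).map f) ≫ act h V' =
      act h V ≫ (T.res β).map ((T.res (.subtype H)).map f) := by
  rw [← cancel_mono (resComp (Eq.refl ((Emb.subtype H).comp β)) V').hom]
  simp only [act, Category.assoc, Iso.inv_hom_id, Category.comp_id]
  rw [resComp_naturality, Iso.inv_hom_id_assoc, ← twist_naturality,
    reassoc_of% resComp_naturality (Eq.refl ((Emb.subtype H).comp α))]

theorem resHom_act {j : Emb I J} {α' β' : Emb I H} (hα : α.comp j = α') (hβ : β.comp j = β')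
    (h' : ((Emb.subtype H).comp α').conj g = (Emb.subtype H).comp β') (V : T.Cat G) :
    resHom hα hβ (act h V) = act h' V := by
  subst hα hβ
  rw [← cancel_epi (resComp (Eq.refl (α.comp j)) _).hom, ← map_comp_resComp,
    ← cancel_mono (resComp (Eq.refl ((Emb.subtype H).comp (β.comp j))) V).hom]
  simp only [act, Category.assoc, Iso.inv_hom_id, Category.comp_id, Functor.map_comp]
  rw [← resComp_assoc (Eq.refl (β.comp j)) (Eq.refl ((Emb.subtype H).comp β))
      (Emb.comp_assoc _ β j), ← Functor.map_comp_assoc _ (Iso.inv _),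
    Iso.inv_hom_id, CategoryTheory.Functor.map_id, Category.id_comp,
    map_twist (Emb.comp_assoc _ α j) (Emb.comp_assoc _ β j) h h',
    reassoc_of% resComp_assoc (Eq.refl (α.comp j)) (Eq.refl ((Emb.subtype H).comp α))
      (Emb.comp_assoc _ α j)]

variable [H.FiniteIndex]

theorem component_map_coindUnit (V : T.Cat G) :
    component h ((T.res (.subtype H)).map (coindUnit H V)) = act h V := by
  have := component_comp_coindUnit h (Eq.refl ((Emb.subtype H).comp β)) h
    (𝟙 ((T.res (.subtype H)).obj V))
  rw [Category.id_comp, CategoryTheory.Functor.map_id, Category.id_comp] at this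
  rw [← cancel_mono (resComp (Eq.refl ((Emb.subtype H).comp β)) V).hom, this, act]
  simp only [Category.assoc, Iso.inv_hom_id, Category.comp_id]

end Act

/-! ### Comonadic descent -/

section ComonadicDescent

variable {H : Subgroup G} [H.FiniteIndex] {c : k} (hc : c * H.index = 1)

include hc

theorem res_map_injective {V V' : T.Cat G} {f f' : V ⟶ V'}
    (h : (T.res (.subtype H)).map f = (T.res (.subtype H)).map f') : f = f' := by
  rw [← Category.comp_id f, ← Category.comp_id f', ← coindUnit_average hc,
    reassoc_of% coindUnit_naturality H f, reassoc_of% coindUnit_naturality H f', h]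

theorem exists_res_map_eq {V V' : T.Cat G}
    (f : (T.res (.subtype H)).obj V ⟶ (T.res (.subtype H)).obj V')
    (hf : (T.res (.subtype H)).map (coindUnit H V) ≫
        (T.res (.subtype H)).map ((T.coind H).map f) =
      f ≫ (T.res (.subtype H)).map (coindUnit H V')) :
    ∃ f₀ : V ⟶ V', (T.res (.subtype H)).map f₀ = f := by
  refine ⟨coindUnit H V ≫ (T.coind H).map f ≫ average H c V', ?_⟩
  rw [Functor.map_comp, Functor.map_comp, reassoc_of% hf, ← Functor.map_comp,
    coindUnit_average hc, CategoryTheory.Functor.map_id, Category.comp_id]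

omit hc in
variable (c) in
theorem map_average_comp_map_eq {W : T.Cat H}
    {s : W ⟶ (T.res (.subtype H)).obj ((T.coind H).obj W)}
    (coassoc : s ≫ (T.res (.subtype H)).map (coindUnit H ((T.coind H).obj W)) =
      s ≫ (T.res (.subtype H)).map ((T.coind H).map s)) :
    ((T.coind H).map s ≫ average H c _) ≫ (T.coind H).map s =
      ((T.coind H).map s ≫ average H c _) ≫ coindUnit H _ := by
  simp only [Category.assoc, ← average_naturality, ← Functor.map_comp_assoc, coassoc]

/-- The descended object is the image of the idempotent `Coind s ≫ average` of `Coind W`. -/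
theorem exists_descent {W : T.Cat H} {s : W ⟶ (T.res (.subtype H)).obj ((T.coind H).obj W)}
    (counit : s ≫ coindCounit W = 𝟙 W)
    (coassoc : s ≫ (T.res (.subtype H)).map (coindUnit H ((T.coind H).obj W)) =
      s ≫ (T.res (.subtype H)).map ((T.coind H).map s)) :
    ∃ (V : T.Cat G) (f : (T.res (.subtype H)).obj V ≅ W),
      f.hom ≫ s = (T.res (.subtype H)).map (coindUnit H V) ≫
        (T.res (.subtype H)).map ((T.coind H).map f.hom) := by
  let e := (T.coind H).map s ≫ average H c ((T.coind H).obj W)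
  have e_map : e ≫ (T.coind H).map s = e ≫ coindUnit H _ := map_average_comp_map_eq c coassoc
  have e_idem : e ≫ e = e := by
    rw [reassoc_of% e_map, coindUnit_average hc, Category.comp_id]
  have s_map_e : s ≫ (T.res (.subtype H)).map e = s := by
    rw [Functor.map_comp, ← reassoc_of% coassoc, ← Functor.map_comp, coindUnit_average hc,
      CategoryTheory.Functor.map_id, Category.comp_id]
  obtain ⟨V, i, q, iq, qi⟩ := (T.isIdempotentComplete G).idempotents_split _ e e_idem
  have i_e : i ≫ e = i := by rw [← qi, reassoc_of% iq]
  have i_map : i ≫ (T.coind H).map s = i ≫ coindUnit H _ := by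
    simpa only [← Category.assoc, i_e] using i ≫= e_map
  let f := (T.res (.subtype H)).map i ≫ coindCounit W
  have f_s : f ≫ s = (T.res (.subtype H)).map i := by
    rw [Category.assoc, ← coindCounit_naturality, ← Functor.map_comp_assoc, i_map,
      Functor.map_comp_assoc, coindUnit_coindCounit, Category.comp_id]
  refine ⟨V, ⟨f, s ≫ (T.res (.subtype H)).map q, ?_, ?_⟩, ?_⟩
  · rw [reassoc_of% f_s, ← Functor.map_comp, iq, CategoryTheory.Functor.map_id]
  · rw [Category.assoc, ← Functor.map_comp_assoc, qi, reassoc_of% s_map_e, counit]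
  · have hi : coindUnit H V ≫ (T.coind H).map f = i := by
      rw [Functor.map_comp, ← reassoc_of% coindUnit_naturality H i, coindUnit_map_coindCounit,
        Category.comp_id]
    exact f_s.trans (by rw [← Functor.map_comp, hi])

end ComonadicDescent

end RepSystem

/-! ### Descent of morphisms -/

namespace Emb

variable {J K G : Type u} [Group J] [Group K] [Group G] (H : Subgroup G)

/-- The inclusion of `H[g]` into `H`. -/
protected abbrev interIncl (g : G) : Emb (inter1 H g) H :=
  ⟨Subgroup.inclusion inf_le_right, Subgroup.inclusion_injective _⟩

/-- The embedding `x ↦ g x g⁻¹` of `H[g]` into `H`. -/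
protected abbrev interConj (g : G) : Emb (inter1 H g) H :=
  ⟨conjHom g (inter1 H g) H (inter1_conj H g), conjHom_injective _ _ _ _⟩

theorem conj_comp_interIncl (g : G) :
    ((Emb.subtype H).comp (.interIncl H g)).conj g = (Emb.subtype H).comp (.interConj H g) :=
  rfl

variable {H}

/-- The factorization through `H[g]` of an embedding whose conjugate by `g` has values in `H`. -/
protected def toInter {α β : Emb J H} {g : G}
    (h : ((Emb.subtype H).comp α).conj g = (Emb.subtype H).comp β) : Emb J (inter1 H g) :=
  ((Emb.subtype H).comp α).codRestrict _ fun x ↦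
    ⟨mem_conjBy.2 ((show g * α x * g⁻¹ = β x from DFunLike.congr_fun h x) ▸ (β x).2), (α x).2⟩

variable {α β : Emb J H} {g : G} (h : ((Emb.subtype H).comp α).conj g = (Emb.subtype H).comp β)

theorem interIncl_comp_toInter : (Emb.interIncl H g).comp (Emb.toInter h) = α := rfl

theorem interConj_comp_toInter : (Emb.interConj H g).comp (Emb.toInter h) = β :=
  hom_ext fun x ↦ Subtype.ext (DFunLike.congr_fun h x)

end Emb

namespace RepSystem

variable {k : Type u} [CommRing k] {T : RepSystem.{u, a, b} k}
variable {J G : Type u} [Group J] [Group G] {H : Subgroup G} {V V' : T.Cat G}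

theorem isInvariant_iff (f : (T.res (.subtype H)).obj V ⟶ (T.res (.subtype H)).obj V') :
    T.toResSystem.IsInvariant H f ↔ ∀ g : G,
      (T.res (.interIncl H g)).map f ≫ act (Emb.conj_comp_interIncl H g) V' =
        act (Emb.conj_comp_interIncl H g) V ≫ (T.res (.interConj H g)).map f := by
  refine forall_congr' fun g ↦ ?_
  let ι : Emb (inter1 H g) G := .subtype _
  let γ : Emb (inter1 H g) G := ⟨conjHomTop g _, conjHomTop_injective g _⟩
  have hι : (Emb.subtype H).comp (.interIncl H g) = ι := rfl
  have hγ : (Emb.subtype H).comp (.interConj H g) = γ := rfl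
  have hιγ : ι.conj g = γ := rfl
  change (twist hιγ V).hom ≫ (resComp hγ V).inv ≫
      (T.res (.interConj H g)).map f ≫ (resComp hγ V').hom =
    ((resComp hι V).inv ≫ (T.res (.interIncl H g)).map f ≫ (resComp hι V').hom) ≫
      (twist hιγ V').hom ↔ _
  rw [act_eq _ hι hγ hιγ, act_eq _ hι hγ hιγ, ← cancel_mono (resComp hγ V').inv,
    ← cancel_epi (resComp hι V).hom]
  simp only [Category.assoc, Iso.hom_inv_id, Iso.hom_inv_id_assoc, Category.comp_id]
  exact eq_comm

theorem isInvariant_res_map (f : V ⟶ V') :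
    T.toResSystem.IsInvariant H ((T.res (.subtype H)).map f) :=
  (isInvariant_iff _).2 fun _ ↦ act_naturality _ f

theorem map_comp_act {f : (T.res (.subtype H)).obj V ⟶ (T.res (.subtype H)).obj V'}
    (hf : T.toResSystem.IsInvariant H f) {α β : Emb J H} {g : G}
    (h : ((Emb.subtype H).comp α).conj g = (Emb.subtype H).comp β) :
    (T.res α).map f ≫ act h V' = act h V ≫ (T.res β).map f := by
  have hα := Emb.interIncl_comp_toInter h
  have hβ := Emb.interConj_comp_toInter h
  have hg := congrArg (resHom hα hβ) ((isInvariant_iff f).1 hf g)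
  rwa [resHom_comp hα hα hβ, resHom_comp hα hβ hβ, resHom_map, resHom_map,
    resHom_act _ hα hβ h, resHom_act _ hα hβ h] at hg

variable [H.FiniteIndex] {c : k} (hc : c * H.index = 1)

include hc

theorem exists_res_map_eq_of_isInvariant
    {f : (T.res (.subtype H)).obj V ⟶ (T.res (.subtype H)).obj V'}
    (hf : T.toResSystem.IsInvariant H f) : ∃ f₀ : V ⟶ V', (T.res (.subtype H)).map f₀ = f := by
  refine exists_res_map_eq hc f (component_ext fun g ↦ ?_)
  have h := Emb.conj_comp_subtype_mackey H (.subtype H) g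
  calc
    _ = act h V ≫ (T.res (.mackey H (.subtype H) g)).map f := by
      rw [component_comp, component_map_coindUnit]
    _ = (T.res (.subtype _)).map f ≫ act h V' := (map_comp_act hf h).symm
    _ = _ := by rw [comp_component, component_map_coindUnit]

theorem morphismsDescend : T.toResSystem.MorphismsDescend H := fun _ _ ↦
  ⟨fun f _ ↦ isInvariant_res_map f, fun _ _ _ _ h ↦ res_map_injective hc h, fun _ hf ↦
    let ⟨f₀, h₀⟩ := exists_res_map_eq_of_isInvariant hc hf
    ⟨f₀, trivial, h₀⟩⟩

end RepSystem

/-! ### Gluing families -/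

namespace Emb

variable {J G : Type u} [Group J] [Group G] (H : Subgroup G) (g₂ g₁ : G)

/-- The inclusion of `H[g₂, g₁]` into `H`. -/
protected abbrev inter₂Incl : Emb (inter2 H g₂ g₁) H :=
  ⟨Subgroup.inclusion inf_le_right, Subgroup.inclusion_injective _⟩

/-- The embedding `x ↦ g₁ x g₁⁻¹` of `H[g₂, g₁]` into `H`. -/
protected abbrev inter₂Conj : Emb (inter2 H g₂ g₁) H :=
  ⟨conjHom g₁ (inter2 H g₂ g₁) H (inter2_conj H g₂ g₁), conjHom_injective _ _ _ _⟩

/-- The embedding `x ↦ (g₂ g₁) x (g₂ g₁)⁻¹` of `H[g₂, g₁]` into `H`. -/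
protected abbrev inter₂ConjMul : Emb (inter2 H g₂ g₁) H :=
  ⟨conjHom (g₂ * g₁) (inter2 H g₂ g₁) H (inter2_conj_mul H g₂ g₁), conjHom_injective _ _ _ _⟩

theorem conj_comp_inter₂Incl :
    ((Emb.subtype H).comp (.inter₂Incl H g₂ g₁)).conj g₁ =
      (Emb.subtype H).comp (.inter₂Conj H g₂ g₁) :=
  rfl

theorem conj_mul_comp_inter₂Incl :
    ((Emb.subtype H).comp (.inter₂Incl H g₂ g₁)).conj (g₂ * g₁) =
      (Emb.subtype H).comp (.inter₂ConjMul H g₂ g₁) :=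
  rfl

theorem conj_comp_inter₂Conj :
    ((Emb.subtype H).comp (.inter₂Conj H g₂ g₁)).conj g₂ =
      (Emb.subtype H).comp (.inter₂ConjMul H g₂ g₁) := by
  rw [← conj_comp_inter₂Incl, conj_conj, conj_mul_comp_inter₂Incl]

end Emb

namespace RepSystem

variable {k : Type u} [CommRing k] {T : RepSystem.{u, a, b} k}
variable {I J G : Type u} [Group I] [Group J] [Group G] {H : Subgroup G} {W : T.Cat H}

/-- The restriction of the member at `g` of a gluing family along the factorization of `α`
through `H[g]`. -/
def glue (σ : T.toResSystem.GluingFamily H W) {α β : Emb J H} {g : G}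
    (h : ((Emb.subtype H).comp α).conj g = (Emb.subtype H).comp β) :
    (T.res α).obj W ⟶ (T.res β).obj W :=
  resHom (φ := .interIncl H g) (ψ := .interConj H g) (Emb.interIncl_comp_toInter h)
    (Emb.interConj_comp_toInter h) (σ g).hom

variable {σ : T.toResSystem.GluingFamily H W} {α β : Emb J H} {g : G}

theorem glue_inter (g : G) : glue σ (Emb.conj_comp_interIncl H g) = (σ g).hom :=
  resHom_refl (φ := .interIncl H g) (ψ := .interConj H g) rfl rfl (σ g).hom

theorem resHom_glue (h : ((Emb.subtype H).comp α).conj g = (Emb.subtype H).comp β) {j : Emb I J}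
    {α' β' : Emb I H} (hα : α.comp j = α') (hβ : β.comp j = β')
    (h' : ((Emb.subtype H).comp α').conj g = (Emb.subtype H).comp β') :
    resHom hα hβ (glue σ h) = glue σ h' := by
  subst hα hβ
  exact resHom_resHom _ _ (Eq.refl ((Emb.toInter h).comp j)) _ _ _ _ _

theorem glue_coe (hI : T.toResSystem.ExtendsTau σ) {x : H} (hx : α.conj x = β)
    (h : ((Emb.subtype H).comp α).conj (x : G) = (Emb.subtype H).comp β) :
    glue σ h = (twist hx W).hom := by
  have h' : (Emb.interIncl H (x : G)).conj x = .interConj H x := rfl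
  have hσ : (σ x).hom = (twist h' W).hom := hI x
  rw [glue, hσ]
  exact resHom_twist _ _ h' hx

theorem glue_one (hI : T.toResSystem.ExtendsTau σ)
    (h : ((Emb.subtype H).comp α).conj 1 = (Emb.subtype H).comp α) : glue σ h = 𝟙 _ :=
  (glue_coe hI (Emb.conj_one α) h).trans (twist_one _ W)

theorem glue_inter₂_comp (hII : T.toResSystem.IsCocycle σ) (g₂ g₁ : G) :
    glue σ (Emb.conj_comp_inter₂Incl H g₂ g₁) ≫ glue σ (Emb.conj_comp_inter₂Conj H g₂ g₁) =
      glue σ (Emb.conj_mul_comp_inter₂Incl H g₂ g₁) :=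
  hII g₁ g₂

theorem glue_comp (hII : T.toResSystem.IsCocycle σ) {γ : Emb J H} {g₁ g₂ : G}
    (h₁ : ((Emb.subtype H).comp α).conj g₁ = (Emb.subtype H).comp β)
    (h₂ : ((Emb.subtype H).comp β).conj g₂ = (Emb.subtype H).comp γ)
    (h : ((Emb.subtype H).comp α).conj (g₂ * g₁) = (Emb.subtype H).comp γ) :
    glue σ h₁ ≫ glue σ h₂ = glue σ h := by
  have hβ (x : J) : g₁ * α x * g₁⁻¹ = β x := DFunLike.congr_fun h₁ x
  have hγ (x : J) : g₂ * g₁ * α x * (g₂ * g₁)⁻¹ = γ x := DFunLike.congr_fun h x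
  let j : Emb J (inter2 H g₂ g₁) := ((Emb.subtype H).comp α).codRestrict _ fun x ↦
    ⟨⟨mem_conjBy.2 (hγ x ▸ (γ x).2), mem_conjBy.2 (hβ x ▸ (β x).2)⟩, (α x).2⟩
  have jα : (Emb.inter₂Incl H g₂ g₁).comp j = α := rfl
  have jβ : (Emb.inter₂Conj H g₂ g₁).comp j = β := Emb.hom_ext fun x ↦ Subtype.ext (hβ x)
  have jγ : (Emb.inter₂ConjMul H g₂ g₁).comp j = γ := Emb.hom_ext fun x ↦ Subtype.ext (hγ x)
  rw [← resHom_glue (Emb.conj_comp_inter₂Incl H g₂ g₁) jα jβ,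
    ← resHom_glue (Emb.conj_comp_inter₂Conj H g₂ g₁) jβ jγ,
    ← resHom_glue (Emb.conj_mul_comp_inter₂Incl H g₂ g₁) jα jγ, ← resHom_comp,
    glue_inter₂_comp hII]

end RepSystem

/-! ### The coaction of a gluing family -/

namespace Emb

variable {I J G : Type u} [Group I] [Group J] [Group G] {H : Subgroup G}
variable {κ : Emb J G} {θ : Emb I J} {β : Emb I H} {g : G}
  (h : (κ.comp θ).conj g = (Emb.subtype H).comp β)

/-- The factorization through `J ∩ g⁻¹ H g` of an embedding whose conjugate by `g` has values
in `H`. -/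
protected def toMackey : Emb I (PlainRep.mackeySubgroup H κ.toMonoidHom g) :=
  θ.codRestrict _ fun x ↦ show g * κ (θ x) * g⁻¹ ∈ H from
    (show g * κ (θ x) * g⁻¹ = β x from DFunLike.congr_fun h x) ▸ (β x).2

theorem subtype_comp_toMackey : (Emb.subtype _).comp (Emb.toMackey h) = θ := rfl

theorem mackey_comp_toMackey : (Emb.mackey H κ g).comp (Emb.toMackey h) = β :=
  hom_ext fun x ↦ Subtype.ext (DFunLike.congr_fun h x)

end Emb

namespace RepSystem

variable {k : Type u} [CommRing k] {T : RepSystem.{u, a, b} k}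
variable {I J G : Type u} [Group I] [Group J] [Group G] {H : Subgroup G} [H.FiniteIndex]

section Restriction

variable {β : Emb J H} {θ : Emb I J} {γ : Emb I H} {g g' : G} {X : T.Cat H}

theorem component_comp_resComp (h : (((Emb.subtype H).comp β).comp θ).conj g =
      (Emb.subtype H).comp γ) (h' : ((Emb.subtype H).comp (β.comp θ)).conj g =
      (Emb.subtype H).comp γ) {α : Emb J H} {W : T.Cat H}
    (m : (T.res α).obj W ⟶ (T.res β).obj ((T.res (.subtype H)).obj ((T.coind H).obj X))) :
    component h (m ≫ (resComp (Eq.refl ((Emb.subtype H).comp β)) _).hom) =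
      (resComp (Eq.refl (α.comp θ)) W).hom ≫
        resHom (Eq.refl (α.comp θ)) (Eq.refl (β.comp θ)) m ≫
          (resComp (Eq.refl ((Emb.subtype H).comp (β.comp θ))) _).hom ≫ eval h' X := by
  rw [← reassoc_of% map_comp_resComp, component, Functor.map_comp_assoc,
    reassoc_of% resComp_assoc (Eq.refl (β.comp θ)) (Eq.refl ((Emb.subtype H).comp β))
      (Eq.refl (((Emb.subtype H).comp β).comp θ)) (Emb.comp_assoc _ β θ).symm]
  rfl

theorem act_resComp_eval {α β γ : Emb J H}
    (h : ((Emb.subtype H).comp α).conj g = (Emb.subtype H).comp β)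
    (h' : ((Emb.subtype H).comp β).conj g' = (Emb.subtype H).comp γ)
    (h'' : ((Emb.subtype H).comp α).conj (g' * g) = (Emb.subtype H).comp γ) :
    act h ((T.coind H).obj X) ≫ (resComp (Eq.refl ((Emb.subtype H).comp β)) _).hom ≫ eval h' X =
      (resComp (Eq.refl ((Emb.subtype H).comp α)) _).hom ≫ eval h'' X := by
  rw [act, Category.assoc, Category.assoc, Iso.inv_hom_id_assoc, twist_eval h h' h'']

end Restriction

variable {W : T.Cat H} {σ : T.toResSystem.GluingFamily H W}
  {s : W ⟶ (T.res (.subtype H)).obj ((T.coind H).obj W)}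

/-- The components of `s` at `g` are the restrictions of the member at `g` of the gluing
family `σ`. -/
def IsCoactionAt (σ : T.toResSystem.GluingFamily H W)
    (s : W ⟶ (T.res (.subtype H)).obj ((T.coind H).obj W)) (g : G) : Prop :=
  ∀ (J : Type u) [Group J] (α β : Emb J H)
    (h : ((Emb.subtype H).comp α).conj g = (Emb.subtype H).comp β), component h s = glue σ h

theorem isCoactionAt_of_component_eq {g : G}
    (hs : component (Emb.conj_comp_subtype_mackey H (.subtype H) g) s =
      glue σ (Emb.conj_comp_subtype_mackey H (.subtype H) g)) : IsCoactionAt σ s g := by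
  intro J _ α β h
  have hg := Emb.conj_comp_subtype_mackey H (.subtype H) g
  have hα := Emb.subtype_comp_toMackey h
  have hβ := Emb.mackey_comp_toMackey h
  rw [← cancel_epi (resComp hα W).hom, ← map_component hg hα hβ h s, hs, map_comp_resComp hα hβ,
    resHom_glue hg hα hβ h]

theorem IsCoactionAt.mul_mul {g : G} (hs : IsCoactionAt σ s g) (hI : T.toResSystem.ExtendsTau σ)
    (hII : T.toResSystem.IsCocycle σ) (y x : H) : IsCoactionAt σ s (y * (g * x)) := by
  intro J _ α β h
  have hα : ((Emb.subtype H).comp α).conj (x : G) = (Emb.subtype H).comp (α.conj x) :=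
    (Emb.comp_conj _ α x).symm
  have hβ : (β.conj y⁻¹).conj y = β := by rw [Emb.conj_conj, mul_inv_cancel, Emb.conj_one]
  have hβ' : ((Emb.subtype H).comp (β.conj y⁻¹)).conj (y : G) = (Emb.subtype H).comp β := by
    exact (Emb.comp_conj (.subtype H) (β.conj y⁻¹) y).symm.trans (congrArg _ hβ)
  have hg : ((Emb.subtype H).comp (α.conj x)).conj g = (Emb.subtype H).comp (β.conj y⁻¹) := by
    refine .trans ?_ (Emb.comp_conj (.subtype H) β y⁻¹).symm
    rw [← hα, ← h, Emb.conj_conj, Emb.conj_conj]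
    exact congrArg _ (inv_mul_cancel_left (y : G) _).symm
  have hgx : ((Emb.subtype H).comp α).conj (g * x) = (Emb.subtype H).comp (β.conj y⁻¹) := by
    rw [← Emb.conj_conj, hα, hg]
  calc
    component h s = (twist rfl W).hom ≫ component hg s ≫ (twist hβ W).hom :=
      (twist_component_twist rfl hβ hg h s).symm
    _ = glue σ hα ≫ glue σ hg ≫ glue σ hβ' := by
      rw [hs, ← glue_coe hI rfl hα, ← glue_coe hI hβ hβ']
    _ = glue σ h := by
      rw [reassoc_of% glue_comp hII hα hg hgx, glue_comp hII hgx hβ' h]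

/-- The components of `s` are the restrictions of the members of the gluing family `σ`. -/
def IsCoaction (σ : T.toResSystem.GluingFamily H W)
    (s : W ⟶ (T.res (.subtype H)).obj ((T.coind H).obj W)) : Prop :=
  ∀ g, IsCoactionAt σ s g

theorem exists_isCoaction (hI : T.toResSystem.ExtendsTau σ) (hII : T.toResSystem.IsCocycle σ) :
    ∃ s : W ⟶ (T.res (.subtype H)).obj ((T.coind H).obj W), IsCoaction σ s := by
  obtain ⟨s, hs⟩ := exists_component_eq (T := T) (κ := .subtype H) fun g ↦
    glue σ (Emb.conj_comp_subtype_mackey H (.subtype H) g)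
  refine ⟨s, fun g ↦ ?_⟩
  obtain ⟨y, _, hy, ⟨x, rfl⟩, hg⟩ := DoubleCoset.mk_out_eq_mul H H.subtype.range g
  have hsg := isCoactionAt_of_component_eq
    (hs (DoubleCoset.mk H (Emb.subtype H).toMonoidHom.range g))
  have := hsg.mul_mul hI hII ⟨y, hy⟩⁻¹ x⁻¹
  rw [hg] at this
  simpa [mul_assoc] using this

namespace IsCoaction

theorem counit (hs : IsCoaction σ s) (hI : T.toResSystem.ExtendsTau σ) :
    s ≫ coindCounit W = 𝟙 W := by
  have h : ((Emb.subtype H).comp (.refl H)).conj 1 = (Emb.subtype H).comp (.refl H) :=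
    Emb.conj_one _
  have h₁ : component h s = 𝟙 _ := (hs 1 H _ _ h).trans (glue_one hI h)
  rw [← cancel_epi (resId W).hom, ← reassoc_of% resId_naturality s, ← eval_one rfl h]
  have := h₁ =≫ (resId W).hom
  simp only [component, Category.assoc] at this
  exact this.trans ((Category.id_comp _).trans (Category.comp_id _).symm)

theorem component_map_comp_act (hs : IsCoaction σ s) (hII : T.toResSystem.IsCocycle σ)
    {α β : Emb J H} {g g' : G} (h : ((Emb.subtype H).comp α).conj g = (Emb.subtype H).comp β)
    {θ : Emb I J} {γ : Emb I H}
    (h' : (((Emb.subtype H).comp β).comp θ).conj g' = (Emb.subtype H).comp γ) :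
    component h' (((T.res α).map s ≫ act h ((T.coind H).obj W)) ≫
        (resComp (Eq.refl ((Emb.subtype H).comp β)) _).hom) =
      component h' ((glue σ h ≫ (T.res β).map s) ≫
        (resComp (Eq.refl ((Emb.subtype H).comp β)) _).hom) := by
  have hθ : ((Emb.subtype H).comp (α.comp θ)).conj g = (Emb.subtype H).comp (β.comp θ) := by
    rw [← Emb.comp_assoc, ← Emb.conj_comp, h, Emb.comp_assoc]
  have hγ : ((Emb.subtype H).comp (α.comp θ)).conj (g' * g) = (Emb.subtype H).comp γ := by
    rw [← Emb.conj_conj, hθ, ← h', Emb.comp_assoc]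
  have hβ : ((Emb.subtype H).comp (β.comp θ)).conj g' = (Emb.subtype H).comp γ := h'
  rw [component_comp_resComp h' hβ, component_comp_resComp h' hβ,
    resHom_comp _ (Eq.refl (α.comp θ)), resHom_comp _ (Eq.refl (β.comp θ)), resHom_map,
    resHom_map, resHom_act h _ _ hθ, resHom_glue h _ _ hθ, Category.assoc, Category.assoc,
    act_resComp_eval hθ hβ hγ]
  congr 1
  calc
    (T.res (α.comp θ)).map s ≫ (resComp (Eq.refl _) _).hom ≫ eval hγ W = glue σ hγ := hs _ _ _ _ hγ
    _ = glue σ hθ ≫ glue σ hβ := (glue_comp hII hθ hβ hγ).symm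
    _ = glue σ hθ ≫ (T.res (β.comp θ)).map s ≫ (resComp (Eq.refl _) _).hom ≫ eval hβ W :=
      congrArg (glue σ hθ ≫ ·) (hs g' _ _ _ hβ).symm

theorem coassoc (hs : IsCoaction σ s) (hII : T.toResSystem.IsCocycle σ) :
    s ≫ (T.res (.subtype H)).map (coindUnit H ((T.coind H).obj W)) =
      s ≫ (T.res (.subtype H)).map ((T.coind H).map s) := by
  refine component_ext fun g ↦ ?_
  rw [comp_component, component_map_coindUnit, component_comp, hs,
    ← cancel_mono (resComp (Eq.refl ((Emb.subtype H).comp (.mackey H (.subtype H) g))) _).hom]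
  exact component_ext fun g' ↦ hs.component_map_comp_act hII _ _

end IsCoaction

end RepSystem

/-! ### Descent of objects -/

namespace RepSystem

variable {k : Type u} [CommRing k] {T : RepSystem.{u, a, b} k}
variable {G : Type u} [Group G] {H : Subgroup G}
variable {W : T.Cat H} {σ : T.toResSystem.GluingFamily H W}

theorem isExtension_iff {V : T.Cat G} (f : (T.res (.subtype H)).obj V ≅ W) :
    T.toResSystem.IsExtension σ V f ↔ ∀ g : G,
      act (Emb.conj_comp_interIncl H g) V ≫ (T.res (.interConj H g)).map f.hom =
        (T.res (.interIncl H g)).map f.hom ≫ glue σ (Emb.conj_comp_interIncl H g) := by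
  refine forall_congr' fun g ↦ ?_
  let ι : Emb (inter1 H g) G := .subtype _
  let γ : Emb (inter1 H g) G := ⟨conjHomTop g _, conjHomTop_injective g _⟩
  have hι : (Emb.subtype H).comp (.interIncl H g) = ι := rfl
  have hγ : (Emb.subtype H).comp (.interConj H g) = γ := rfl
  have hιγ : ι.conj g = γ := rfl
  let s : (T.res (.interIncl H g)).obj W ⟶ (T.res (.interConj H g)).obj W := (σ g).hom
  have hs : glue σ (Emb.conj_comp_interIncl H g) = s := glue_inter g
  change (twist hιγ V).hom ≫ (resComp hγ V).inv ≫ (T.res (.interConj H g)).map f.hom =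
    ((resComp hι V).inv ≫ (T.res (.interIncl H g)).map f.hom) ≫ s ↔ _
  rw [hs, act_eq _ hι hγ hιγ, ← cancel_epi (resComp hι V).hom]
  simp only [Category.assoc, Iso.hom_inv_id_assoc]

theorem isInvariant_of_comp_eq {V V' : T.Cat G} {f : (T.res (.subtype H)).obj V ≅ W}
    {f' : (T.res (.subtype H)).obj V' ≅ W} (hf : T.toResSystem.IsExtension σ V f)
    (hf' : T.toResSystem.IsExtension σ V' f')
    {φ : (T.res (.subtype H)).obj V ⟶ (T.res (.subtype H)).obj V'} (hφ : φ ≫ f'.hom = f.hom) :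
    T.toResSystem.IsInvariant H φ := by
  refine (isInvariant_iff φ).2 fun g ↦ ?_
  rw [← cancel_mono ((T.res (.interConj H g)).map f'.hom), Category.assoc,
    (isExtension_iff f').1 hf' g, ← Functor.map_comp_assoc, hφ, Category.assoc,
    ← Functor.map_comp, hφ, (isExtension_iff f).1 hf g]

variable [H.FiniteIndex] {c : k} (hc : c * H.index = 1)

include hc

theorem exists_isExtension (hI : T.toResSystem.ExtendsTau σ) (hII : T.toResSystem.IsCocycle σ) :
    ∃ (V : T.Cat G) (f : (T.res (.subtype H)).obj V ≅ W), T.toResSystem.IsExtension σ V f := by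
  obtain ⟨s, hs⟩ := exists_isCoaction hI hII
  obtain ⟨V, f, hfs⟩ := exists_descent hc (hs.counit hI) (hs.coassoc hII)
  refine ⟨V, f, (isExtension_iff f).2 fun g ↦ ?_⟩
  rw [← hs g, ← comp_component, hfs, component_comp, component_map_coindUnit]

theorem existsUnique_iso {V V' : T.Cat G} {f : (T.res (.subtype H)).obj V ≅ W}
    {f' : (T.res (.subtype H)).obj V' ≅ W} (hf : T.toResSystem.IsExtension σ V f)
    (hf' : T.toResSystem.IsExtension σ V' f') :
    ∃! e : V ≅ V', (T.res (.subtype H)).map e.hom ≫ f'.hom = f.hom := by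
  obtain ⟨e, he⟩ := exists_res_map_eq_of_isInvariant hc
    (isInvariant_of_comp_eq hf hf' (φ := f.hom ≫ f'.inv) (by simp))
  obtain ⟨e', he'⟩ := exists_res_map_eq_of_isInvariant hc
    (isInvariant_of_comp_eq hf' hf (φ := f'.hom ≫ f.inv) (by simp))
  refine ⟨⟨e, e', res_map_injective hc ?_, res_map_injective hc ?_⟩, ?_,
    fun e₁ h₁ ↦ Iso.ext (res_map_injective hc ?_)⟩
  · simp [he, he']
  · simp [he, he']
  · simp [he]
  · simp [he, ← h₁]

theorem objectsDescend : T.toResSystem.ObjectsDescend H :=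
  fun _ _ hI hII ↦ ⟨exists_isExtension hc hI hII, fun _ _ _ _ ↦ existsUnique_iso hc⟩

end RepSystem

theorem isUnit_natCast_of_coprime {p : ℕ} [Fact p.Prime] {n : ℕ} (hn : n.Coprime p)
    (k : Type u) [CommRing k] [Algebra (ZLocAt p) k] : IsUnit (n : k) := by
  have hp : (n : ℤ) ∉ Ideal.span {(p : ℤ)} := by
    rw [Ideal.mem_span_singleton, Int.natCast_dvd_natCast]
    exact fun h ↦ (Fact.out : p.Prime).one_lt.ne' (Nat.Coprime.eq_one_of_dvd hn.symm h)
  have hu : IsUnit (algebraMap ℤ (ZLocAt p) n) :=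
    IsLocalization.map_units (ZLocAt p) (⟨n, hp⟩ : (Ideal.span {(p : ℤ)}).primeCompl)
  simpa using hu.map (algebraMap (ZLocAt p) k)

theorem mainTheorem1_general {G : Type u} [Group G] (H : Subgroup G) [H.FiniteIndex] :
    (∀ (k : Type u) [CommRing k], IsUnit (H.index : k) →
      ((plainSystem k).MorphismsDescend H ∧ (plainSystem k).ObjectsDescend H) ∧
      ((derivedSystem k).MorphismsDescend H ∧ (derivedSystem k).ObjectsDescend H)) ∧
    (∀ (k : Type u) [Field k], IsUnit (H.index : k) →
      (stableSystem k).MorphismsDescend H ∧ (stableSystem k).ObjectsDescend H) := by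
  refine ⟨fun k _ hk ↦ ?_, fun k _ hk ↦ ?_⟩ <;> obtain ⟨c, hc⟩ := hk.exists_left_inv
  · rw [← plainRepSystem_toResSystem, ← derivedRepSystem_toResSystem]
    exact ⟨⟨RepSystem.morphismsDescend hc, RepSystem.objectsDescend hc⟩,
      RepSystem.morphismsDescend hc, RepSystem.objectsDescend hc⟩
  · rw [← stableRepSystem_toResSystem]
    exact ⟨RepSystem.morphismsDescend hc, RepSystem.objectsDescend hc⟩

end

theorem mainTheorem1 (p : ℕ) [Fact p.Prime] (G : Type u) [Group G] [Finite G]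
    (H : Subgroup G) (hH : H.index.Coprime p) :
    (∀ (k : Type u) [CommRing k] [IsLocalRing k] [Algebra (ZLocAt p) k],
      ((plainSystem k).MorphismsDescend H ∧ (plainSystem k).ObjectsDescend H) ∧
      ((derivedSystem k).MorphismsDescend H ∧ (derivedSystem k).ObjectsDescend H)) ∧
    (∀ (k : Type u) [Field k] [Algebra (ZLocAt p) k],
      (stableSystem k).MorphismsDescend H ∧ (stableSystem k).ObjectsDescend H) := by
  refine ⟨fun k _ _ _ ↦ ?_, fun k _ _ ↦ ?_⟩
  · exact (mainTheorem1_general H).1 k (isUnit_natCast_of_coprime hH k)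
  · exact (mainTheorem1_general H).2 k (isUnit_natCast_of_coprime hH k)
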